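/- For elements $a,b$ of a group write $[a,b]=a^{-1}b^{-1}ab$ and $b^a=a^{-1}ba$. Let $\alpha$ be an integer with $\alpha\notin\{0,1,2\}$, and let $$G(\alpha)=\langle x,y\mid x^{[x,y]}=x^\alpha,\ y^{[y,x]}=y^\alpha\rangle$$ be the Macdonald group. Let $p$ be a prime factor of $\alpha-1$, let $m=v_p(\alpha-1)$, and let $J$ be the Sylow $p$-subgroup of $G(\alpha)$. There is a (necessarily unique) homomorphism $\pi:G(\alpha)\to J$ that is the identity on $J$ and whose kernel consists of elements of finite order prime to $p$ (the projection onto $J$ along the other Sylow subgroups). Put $A=\pi(x)$, $B=\pi(y)$ and $C=[A,B]$. Then every element of $J$ can be written uniquely in the form $A^iB^jC^k$ with integers $0\le i<i_0$, $0\le j<j_0$, $0\le k<k_0$, where: (Case 1) if $p>3$, or $p=3$ and either $m>1$ or $(\alpha-1)/3\equiv 1 \pmod 3$, then $(i_0,j_0,k_0)=(p^{3m},p^{2m},p^{2m})$, and $|J|=p^{7m}$; (Case 2) if $p=2$, then $(i_0,j_0,k_0)=(2^{3m-1},2^{2m-1},2^{2m-1})$, and $|J|=2^{7m-3}$; (Case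 3) if $p=3$, $m=1$ and $(\alpha-1)/3\equiv -1 \pmod 3$, then $(i_0,j_0,k_0)=(81,27,27)$, and $|J|=3^{10}$. -/

import Mathlib

/-- Conjugation `b ^ a = a⁻¹ b a`. -/
def groupConj {T : Type*} [Group T] (b a : T) : T := a⁻¹ * b * a

/-- The commutator with the convention `[a, b] = a⁻¹ b⁻¹ a b`
(Mathlib's `⁅a, b⁆` is `a b a⁻¹ b⁻¹`). -/
def groupComm {T : Type*} [Group T] (a b : T) : T := a⁻¹ * b⁻¹ * a * b

/-- The two relators saying `x ^ [x, y] = x ^ α` and `y ^ [y, x] = y ^ α`, in the free group on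
`x = FreeGroup.of 0` and `y = FreeGroup.of 1`. -/
def macdonaldRels (α : ℤ) : Set (FreeGroup (Fin 2)) :=
  let x : FreeGroup (Fin 2) := FreeGroup.of 0
  let y : FreeGroup (Fin 2) := FreeGroup.of 1
  {groupConj x (groupComm x y) * (x ^ α)⁻¹, groupConj y (groupComm y x) * (y ^ α)⁻¹}

/-- The Macdonald group `G(α) = ⟨x, y | x ^ [x, y] = x ^ α, y ^ [y, x] = y ^ α⟩`. -/
abbrev MacdonaldGroup (α : ℤ) : Type := PresentedGroup (macdonaldRels α)

/-- The first generator of `G(α)`. -/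
def MacdonaldGroup.genA (α : ℤ) : MacdonaldGroup α := PresentedGroup.of 0

/-- The second generator of `G(α)`. -/
def MacdonaldGroup.genB (α : ℤ) : MacdonaldGroup α := PresentedGroup.of 1

/-- `π : G → J` is the projection of `G` onto its Sylow `p`-subgroup `J` with kernel of order prime to `p`:
it is the identity on `J`, and every element of its kernel has (finite) order prime to `p`.
For a finite nilpotent `G` it is the projection onto the factor `J` of the decomposition of `G`
as the direct product of its Sylow subgroups. There is at most one such map, see below.
(`orderOf g = 0` for `g` of infinite order, and `0` is not coprime to a prime `p`.) -/
def IsSylowProjection {p : ℕ} {G : Type*} [Group G] (J : Sylow p G)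
    (π : G →* (J : Subgroup G)) : Prop :=
  (∀ g : (J : Subgroup G), π (g : G) = g) ∧ ∀ g ∈ π.ker, (orderOf g).Coprime p

/-- A Sylow projection is unique, so it is legitimate to speak of the projection onto `J`. -/
theorem IsSylowProjection.unique {p : ℕ} {G : Type*} [Group G] {J : Sylow p G}
    {π π' : G →* (J : Subgroup G)} (h : IsSylowProjection J π) (h' : IsSylowProjection J π') :
    π = π' := by
  ext g
  have hk : g * ((π g : (J : Subgroup G)) : G)⁻¹ ∈ π.ker := by
    rw [MonoidHom.mem_ker, map_mul, map_inv, h.1, mul_inv_cancel]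
  have hc := h.2 _ hk
  set z := g * ((π g : (J : Subgroup G)) : G)⁻¹ with hz
  obtain ⟨k, hk'⟩ := J.isPGroup' (π' z)
  have h1 : orderOf (π' z) ∣ orderOf z := orderOf_map_dvd π' z
  have h2 : orderOf (π' z) ∣ p ^ k := orderOf_dvd_of_pow_eq_one hk'
  have h3 : π' z = 1 :=
    orderOf_eq_one_iff.mp (Nat.eq_one_of_dvd_coprimes (hc.pow_right k) h1 h2)
  rw [hz, map_mul, map_inv, h'.1, mul_inv_eq_one] at h3
  rw [h3]

/-- Every element of `T` can be written uniquely in the form `A ^ i * B ^ j * C ^ k` with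
`0 ≤ i < i₀`, `0 ≤ j < j₀`, `0 ≤ k < k₀`. -/
def HasUniqueNormalForm {T : Type*} [Group T] (A B C : T) (i₀ j₀ k₀ : ℕ) : Prop :=
  ∀ g : T, ∃! t : ℕ × ℕ × ℕ,
    t.1 < i₀ ∧ t.2.1 < j₀ ∧ t.2.2 < k₀ ∧ g = A ^ t.1 * B ^ t.2.1 * C ^ t.2.2

/-- Case 1: `p > 3`, or `p = 3` and either `m > 1` or `(α - 1) / 3 ≡ 1 mod 3`,
where `m = v_p(α - 1)`. The division is exact as `p` is meant to divide `α - 1`. -/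
def MacdonaldCase1 (α : ℤ) (p : ℕ) : Prop :=
  3 < p ∨ (p = 3 ∧ (1 < padicValInt p (α - 1) ∨ (α - 1) / 3 ≡ 1 [ZMOD 3]))

/-- Case 2: `p = 2`. -/
def MacdonaldCase2 (p : ℕ) : Prop := p = 2

/-- Case 3: `p = 3`, `m = 1` and `(α - 1) / 3 ≡ -1 mod 3`, where `m = v_p(α - 1)`. -/
def MacdonaldCase3 (α : ℤ) (p : ℕ) : Prop :=
  p = 3 ∧ padicValInt p (α - 1) = 1 ∧ (α - 1) / 3 ≡ -1 [ZMOD 3]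

/-! The whole argument takes place in groups generated by a triple `a`, `b`, `c` satisfying the
defining relations, a notion symmetric under `(a, b, c) ↦ (b, a, c⁻¹)`. For `M = α ^ k`, moving `c ^
k` through a product in two ways shows that an explicit power of `a` is a power of `b`
(`zpow_left_eq_zpow_right`). Such a power is central, and a central `a ^ x` satisfies `a ^ ((α - 1)
* x) = 1`. Hence `a` and `b` have finite order. Primes not dividing `α - 1` can be removed from a
common exponent (`exists_exponent`), after which the group is finite and, by passing to successive
central quotients, nilpotent. This yields the projection onto `J`.

Upper bound: in a `p`-group the same relation, together with the `p`-adic valuation of its exponent,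
gives `a ^ p ^ (h + m) = 1` and makes `a ^ p ^ h` a power of `b`, where `h` is `2m`, or `2m - 1` for
`p = 2`, or `3` in the exceptional case `α ≡ 7` mod `9`. Then every element has the stated form
(`exists_normalForm`).

Uniqueness: once `a` and `b` are known to have order exactly `p ^ (h + m)`, any relation `a ^ i * b
^ j * c ^ k = 1` has `j` and `k` divisible by `p ^ h` (`dvd_of_relation`). For `p = 2` this also
needs the abelianization.

Lower bound on the orders: explicit permutation models. One polynomial model treats every `α = 1 + 6
* d`, and modulo a power of `p` each relevant `α` has this shape; a finite computation modulo `81`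
settles `α ≡ 7` mod `9`. Replacing `α` by a congruent exponent is harmless in a `p`-group whose
generators have bounded order (`congr_exponent`), so the orders found in a model carry over to `J`
(`hasUniqueNormalForm_projection`). -/

/-- Three elements `a`, `b`, `c` of a group with `c = [a, b]`, `a ^ c = a ^ α` and
`b ^ c⁻¹ = b ^ α`. -/
structure MacdonaldTriple {T : Type*} [Group T] (α : ℤ) (a b c : T) : Prop where
  comm : a * b = b * a * c
  conj_left : a * c = c * a ^ α
  conj_right : c * b = b ^ α * c

/-- The sum `α + α² + ⋯ + α ^ i`. -/
def powSum (α : ℤ) (i : ℕ) : ℤ := ∑ l ∈ Finset.range i, α ^ (l + 1)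

theorem powSum_zero (α : ℤ) : powSum α 0 = 0 := by simp [powSum]

theorem powSum_succ (α : ℤ) (i : ℕ) : powSum α (i + 1) = powSum α i + α ^ (i + 1) := by
  simp [powSum, Finset.sum_range_succ]

theorem mul_powSum (α : ℤ) (i : ℕ) : (α - 1) * powSum α i = α * (α ^ i - 1) := by
  induction i with
  | zero => simp [powSum]
  | succ i ih => rw [powSum_succ, mul_add, ih]; ring

/-! ### Calculus with the relations; the generators have finite order. -/

namespace MacdonaldTriple

variable {T : Type*} [Group T] {α : ℤ} {a b c : T}

theorem swap (h : MacdonaldTriple α a b c) : MacdonaldTriple α b a c⁻¹ where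
  comm := by rw [h.comm]; group
  conj_left := by
    rw [eq_inv_mul_iff_mul_eq, ← mul_assoc, h.conj_right, mul_inv_cancel_right]
  conj_right := by
    rw [eq_mul_inv_iff_mul_eq, mul_assoc, h.conj_left, inv_mul_cancel_left]

theorem map {S : Type*} [Group S] (h : MacdonaldTriple α a b c) (f : T →* S) :
    MacdonaldTriple α (f a) (f b) (f c) where
  comm := by simpa using congrArg f h.comm
  conj_left := by simpa using congrArg f h.conj_left
  conj_right := by simpa using congrArg f h.conj_right

theorem eq_groupComm (h : MacdonaldTriple α a b c) : c = groupComm a b := by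
  have := h.comm
  rw [groupComm, mul_assoc, this]
  group

/-- The exponent may be changed modulo the orders of `a` and `b`. -/
theorem congr_exponent (h : MacdonaldTriple α a b c) {α' : ℤ} {e : ℕ} (ha : a ^ e = 1)
    (hb : b ^ e = 1) (hα : (e : ℤ) ∣ α - α') : MacdonaldTriple α' a b c := by
  obtain ⟨t, ht⟩ := hα
  have hα' : α = α' + e * t := by linarith
  refine ⟨h.comm, ?_, ?_⟩
  · rw [h.conj_left, hα', zpow_add, zpow_mul, zpow_natCast, ha, one_zpow, mul_one]
  · rw [h.conj_right, hα', zpow_add, zpow_mul, zpow_natCast, hb, one_zpow, mul_one]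

theorem zpow_left_mul (h : MacdonaldTriple α a b c) (i : ℤ) : a ^ i * c = c * a ^ (α * i) := by
  have h1 : c⁻¹ * a * c = a ^ α := by rw [mul_assoc, h.conj_left, inv_mul_cancel_left]
  have h2 : c⁻¹ * a ^ i * c = a ^ (α * i) := by
    rw [zpow_mul, ← h1]
    simpa using (conj_zpow (a := c⁻¹) (b := a) (i := i)).symm
  rw [← h2]; group

theorem zpow_left_mul_pow (h : MacdonaldTriple α a b c) (i : ℤ) (k : ℕ) :
    a ^ i * c ^ k = c ^ k * a ^ (α ^ k * i) := by
  induction k generalizing i with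
  | zero => simp
  | succ k ih =>
    rw [pow_succ, ← mul_assoc, ih, mul_assoc, h.zpow_left_mul, ← mul_assoc]
    congr 2; ring

theorem pow_mul_zpow_right (h : MacdonaldTriple α a b c) (i : ℤ) (k : ℕ) :
    c ^ k * b ^ i = b ^ (α ^ k * i) * c ^ k := by
  have := h.swap.zpow_left_mul_pow i k
  rw [inv_pow] at this
  rwa [eq_inv_mul_iff_mul_eq, ← mul_assoc, mul_inv_eq_iff_eq_mul] at this

theorem pow_left_mul_right (h : MacdonaldTriple α a b c) (i : ℕ) :
    a ^ i * b = b * c ^ i * a ^ powSum α i := by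
  induction i with
  | zero => simp [powSum_zero]
  | succ i ih =>
    have h1 := h.zpow_left_mul_pow 1 (i + 1)
    rw [zpow_one, mul_one] at h1
    calc a ^ (i + 1) * b = a * (a ^ i * b) := by rw [pow_succ', mul_assoc]
      _ = (a * b) * c ^ i * a ^ powSum α i := by rw [ih]; group
      _ = b * (a * c ^ (i + 1)) * a ^ powSum α i := by rw [h.comm, pow_succ']; group
      _ = b * c ^ (i + 1) * (a ^ α ^ (i + 1) * a ^ powSum α i) := by
        rw [h1]; simp only [mul_assoc]
      _ = _ := by rw [← zpow_add, powSum_succ, add_comm (α ^ (i + 1))]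

theorem pow_right_mul_left (h : MacdonaldTriple α a b c) (j : ℕ) :
    b ^ j * a = a * (c ^ j)⁻¹ * b ^ powSum α j := by
  rw [h.swap.pow_left_mul_right, inv_pow]

/-- A power of `a` that is also a power of `b`. -/
theorem zpow_left_eq_zpow_right (h : MacdonaldTriple α a b c) {k M : ℕ} (hM : (M : ℤ) = α ^ k) :
    a ^ ((powSum α M - α ^ (k + M)) * α ^ (k + M)) = b ^ (α ^ M * M - powSum α M) := by
  have h1 : b ^ (α ^ M * M - powSum α M) * c ^ (k + M) =
      c ^ (k + M) * a ^ (powSum α M - α ^ (k + M)) := by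
    have e1 := h.pow_left_mul_right M
    have e2 := h.zpow_left_mul_pow 1 k
    have e3 := h.pow_mul_zpow_right 1 k
    have e4 := h.pow_right_mul_left M
    have e5 := h.pow_mul_zpow_right M M
    have e6 := h.zpow_left_mul_pow (-1) (k + M)
    rw [zpow_one, mul_one, ← hM, zpow_natCast] at e2 e3
    -- Both sides equal `a * c ^ k * b`: since `α ^ k = M`, passing `c ^ k` turns `b` into `b ^ M`
    -- on one side and `a` into the natural power `a ^ M` on the other, and `a ^ M * b` is known
    -- from `e1`.
    have e7 : a * b ^ M * c ^ k = b ^ M * c ^ (k + M) * a ^ powSum α M := by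
      calc a * b ^ M * c ^ k = (a * c ^ k) * b := by rw [mul_assoc, ← e3]; group
        _ = c ^ k * (a ^ M * b) := by rw [e2]; group
        _ = (c ^ k * b) * c ^ M * a ^ powSum α M := by rw [e1]; group
        _ = _ := by rw [e3]; group
    have e8 : b ^ M = a * (c ^ M)⁻¹ * b ^ powSum α M * a⁻¹ := by rw [← e4]; group
    have e9 : c ^ M * b ^ M * c ^ k = b ^ powSum α M * a⁻¹ * c ^ (k + M) * a ^ powSum α M := by
      calc c ^ M * b ^ M * c ^ k = c ^ M * a⁻¹ * (a * b ^ M * c ^ k) := by group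
        _ = c ^ M * a⁻¹ * (b ^ M * c ^ (k + M) * a ^ powSum α M) := by rw [e7]
        _ = _ := by rw [e8]; group
    rw [← zpow_natCast b M, e5] at e9
    calc b ^ (α ^ M * M - powSum α M) * c ^ (k + M)
        = (b ^ powSum α M)⁻¹ * (b ^ (α ^ M * M) * c ^ M * c ^ k) := by group
      _ = (a ^ (-1 : ℤ) * c ^ (k + M)) * a ^ powSum α M := by rw [e9]; group
      _ = _ := by rw [e6]; group
  -- `h1` says that a power of `a` and a power of `b` are conjugate under `c ^ (k + M)`. That
  -- conjugation also raises powers of `b` to the `α ^ (k + M)`, so comparing the two removes the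
  -- conjugation.
  have h2 := h.pow_mul_zpow_right (α ^ M * M - powSum α M) (k + M)
  have h3 : b ^ (α ^ (k + M) * (α ^ M * M - powSum α M)) =
      c ^ (k + M) * a ^ ((powSum α M - α ^ (k + M)) * α ^ (k + M)) * (c ^ (k + M))⁻¹ := by
    rw [zpow_mul a, ← conj_zpow, ← h1, mul_inv_cancel_right, ← zpow_mul, mul_comm]
  rw [h3, inv_mul_cancel_right] at h2
  exact (mul_left_cancel h2).symm

theorem commute_comm (h : MacdonaldTriple α a b c) {z : T} (ha : Commute z a) (hb : Commute z b) :
    Commute z c := by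
  rw [h.eq_groupComm, groupComm]
  exact ((ha.inv_right.mul_right hb.inv_right).mul_right ha).mul_right hb

/-- Conjugation by `c` sends `a ^ x` to `a ^ (α * x)`, so if it fixes `a ^ x` the quotient of the
two is trivial. -/
theorem zpow_left_eq_one_of_commute_comm (h : MacdonaldTriple α a b c) {x : ℤ}
    (hx : Commute (a ^ x) c) : a ^ ((α - 1) * x) = 1 := by
  have h1 := h.zpow_left_mul x
  rw [hx.eq] at h1
  have h2 := mul_left_cancel h1
  rw [sub_mul, one_mul, zpow_sub, ← h2, mul_inv_cancel]

theorem zpow_left_eq_one_of_commute_right (h : MacdonaldTriple α a b c) {x : ℤ}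
    (hx : Commute (a ^ x) b) : a ^ ((α - 1) * x) = 1 :=
  h.zpow_left_eq_one_of_commute_comm (h.commute_comm (Commute.zpow_self a x) hx)

theorem zpow_left_eq_one_of_mul (h : MacdonaldTriple α a b c) {x : ℤ} (hx : a ^ (α * x) = 1) :
    a ^ x = 1 := by
  have := h.zpow_left_mul x
  rwa [hx, mul_one, mul_eq_right] at this

theorem zpow_left_eq_one_of_pow_mul (h : MacdonaldTriple α a b c) {x : ℤ} (k : ℕ)
    (hx : a ^ (α ^ k * x) = 1) : a ^ x = 1 := by
  induction k with
  | zero => simpa using hx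
  | succ k ih =>
    refine ih (h.zpow_left_eq_one_of_mul ?_)
    rwa [← mul_assoc, ← pow_succ']

theorem zpow_left_fundamental_eq_one (h : MacdonaldTriple α a b c) {k M : ℕ}
    (hM : (M : ℤ) = α ^ k) : a ^ ((α - 1) * (powSum α M - α ^ (k + M))) = 1 := by
  refine h.zpow_left_eq_one_of_pow_mul (k + M) ?_
  have := h.zpow_left_eq_one_of_commute_right (x := (powSum α M - α ^ (k + M)) * α ^ (k + M))
    (by rw [h.zpow_left_eq_zpow_right hM]; exact Commute.zpow_self b _)
  rw [← this]; ring_nf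

/-- For `α = -1` the only available `M` is `1`, and then the exponent in
`zpow_left_fundamental_eq_one` vanishes. Instead, two expressions for `b * a * b⁻¹` give `a ^ 2 = b
^ (-2)`, which makes `a ^ 2` central. -/
theorem pow_four_eq_one_of_neg_one (h : MacdonaldTriple (-1) a b c) : a ^ (4 : ℤ) = 1 := by
  have h1 := h.comm
  have h2 := h.conj_left
  have h3 := h.conj_right
  rw [zpow_neg_one] at h2 h3
  have e1 : a⁻¹ * b = b * c⁻¹ * a⁻¹ := by
    have : b⁻¹ * a * b = a * c := by rw [mul_assoc, h1]; group
    have : b⁻¹ * a⁻¹ * b = c⁻¹ * a⁻¹ := by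
      have := congrArg (·⁻¹) this
      simpa [mul_assoc] using this
    rw [mul_assoc b, ← this]; group
  have e2 : a⁻¹ = c⁻¹ * a * c := by rw [mul_assoc, h2]; group
  have e3 : b * a * b⁻¹ = a⁻¹ * c⁻¹ := by
    have : c⁻¹ * a * (c * b) = b * c⁻¹ * a⁻¹ := by rw [← e1, e2]; group
    rw [h3] at this
    have h4 : a * b⁻¹ * c = (c * b) * c⁻¹ * a⁻¹ := by
      calc a * b⁻¹ * c = c * (c⁻¹ * a * (b⁻¹ * c)) := by group
        _ = _ := by rw [this]; group
    rw [h3] at h4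
    have h5 : b * (a * b⁻¹ * c) = a⁻¹ := by rw [h4]; group
    rw [← h5]; group
  have e4 : b * a * b⁻¹ = a * c⁻¹ * b ^ (-2 : ℤ) := by
    have h4 : c = b⁻¹ * c * b⁻¹ := by rw [← h3]; group
    have h5 : b * a * c * b⁻¹ = a := by rw [← h1]; group
    have h6 : b * c * b⁻¹ = b ^ (2 : ℤ) * c := by
      nth_rw 1 [h4]
      have : b * (b⁻¹ * c * b⁻¹) * b⁻¹ = c * b ^ (-2 : ℤ) := by group
      rw [this]
      have := h.pow_mul_zpow_right (-2) 1
      simpa using this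
    calc b * a * b⁻¹ = (b * a * c * b⁻¹) * (b * c * b⁻¹)⁻¹ := by group
      _ = _ := by rw [h5, h6]; group
  have e5 : a ^ (2 : ℤ) = b ^ (-2 : ℤ) := by
    have h4 := h.pow_mul_zpow_right (-2) 1
    have h5 := h.pow_mul_zpow_right (2) 1
    simp only [pow_one, neg_mul, one_mul, neg_neg] at h4 h5
    have h6 : a * (a * (c⁻¹ * b ^ (-2 : ℤ))) = c⁻¹ := by
      rw [← mul_assoc a c⁻¹, ← e4, e3]; group
    have h7 : c⁻¹ * b ^ (-2 : ℤ) = b ^ (2 : ℤ) * c⁻¹ := by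
      rw [inv_mul_eq_iff_eq_mul, ← mul_assoc, h5]; group
    rw [h7] at h6
    have h8 : a ^ (2 : ℤ) * b ^ (2 : ℤ) * c⁻¹ = c⁻¹ := by
      rw [zpow_two a]; simpa only [mul_assoc] using h6
    rw [mul_eq_right] at h8
    rw [zpow_neg]; exact eq_inv_of_mul_eq_one_left h8
  have e6 := h.zpow_left_eq_one_of_commute_right (x := 2)
    (by rw [e5]; exact Commute.zpow_self b _)
  have : a ^ (4 : ℤ) = (a ^ ((-1 - 1) * 2 : ℤ))⁻¹ := by rw [← zpow_neg]; norm_num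
  rw [this, e6, inv_one]

/-- The generators have finite order coprime to the exponent. -/
theorem exists_pow_left_eq_one (h : MacdonaldTriple α a b c) (h0 : α ≠ 0) (h1 : α ≠ 1) :
    ∃ e : ℕ, 0 < e ∧ IsCoprime (e : ℤ) α ∧ a ^ e = 1 := by
  suffices ∃ e : ℤ, e ≠ 0 ∧ IsCoprime e α ∧ a ^ e = 1 by
    obtain ⟨e, he, hc, hae⟩ := this
    refine ⟨e.natAbs, Int.natAbs_pos.mpr he, ?_, ?_⟩
    · rcases Int.natAbs_eq e with h2 | h2
      · rwa [← h2]
      · rw [h2] at hc; exact (IsCoprime.neg_left_iff _ _).mp hc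
    · rw [← zpow_natCast]
      rcases Int.natAbs_eq e with h2 | h2
      · rwa [← h2]
      · rw [h2, zpow_neg, inv_eq_one] at hae; exact hae
  by_cases h2 : α = -1
  · subst h2
    exact ⟨4, by norm_num, ⟨0, -1, by norm_num⟩, h.pow_four_eq_one_of_neg_one⟩
  obtain ⟨M, hM⟩ : ∃ M : ℕ, (M : ℤ) = α ^ 2 := ⟨(α ^ 2).toNat, Int.toNat_of_nonneg (sq_nonneg α)⟩
  have hM0 : M ≠ 0 := by
    rintro rfl
    exact h0 (pow_eq_zero_iff (two_ne_zero) |>.mp (by simpa using hM.symm))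
  obtain ⟨M', rfl⟩ := Nat.exists_eq_succ_of_ne_zero hM0
  have key := h.zpow_left_fundamental_eq_one hM
  -- This is the exponent of `zpow_left_fundamental_eq_one` for `k = 2`, divided by `α`. It is `-1`
  -- modulo `α`, hence coprime to `α`, and it can vanish only if `α` is a unit. The choice `k = 2`
  -- makes `α ^ k` a natural number.
  refine ⟨α ^ (M' + 1) * (1 - (α - 1) * α) - 1, ?_, ?_, ?_⟩
  · intro h3
    have : IsUnit α := IsUnit.of_mul_eq_one (α ^ M' * (1 - (α - 1) * α)) (by linear_combination h3)
    rcases Int.isUnit_iff.mp this with h4 | h4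
    · exact h1 h4
    · exact h2 h4
  · exact ⟨-1, α ^ M' * (1 - (α - 1) * α), by ring⟩
  · refine h.zpow_left_eq_one_of_mul ?_
    have : α * (α ^ (M' + 1) * (1 - (α - 1) * α) - 1) =
        (α - 1) * (powSum α M'.succ - α ^ (2 + M'.succ)) := by
      rw [mul_sub (α - 1), mul_powSum]
      simp only [Nat.succ_eq_add_one]
      ring
    rw [this, key]

end MacdonaldTriple

/-! ### Estimates for `p`-adic valuations. -/

section NumberTheory

/-- `1` for the prime `2` and `0` for the others. -/
def twoDefect (p : ℕ) : ℕ := if p = 2 then 1 else 0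

theorem twoDefect_le_one (p : ℕ) : twoDefect p ≤ 1 := by unfold twoDefect; split <;> omega

theorem twoDefect_two : twoDefect 2 = 1 := rfl

theorem twoDefect_of_ne {p : ℕ} (hp : p ≠ 2) : twoDefect p = 0 := if_neg hp

theorem padicValNat_add_two_le {p k : ℕ} (hp : p.Prime) (hk : 2 ≤ k) :
    padicValNat p k + 2 ≤ k + twoDefect p := by
  have h1 : p ^ padicValNat p k ≤ k := Nat.le_of_dvd (by omega) pow_padicValNat_dvd
  set v := padicValNat p k
  by_cases h2 : p = 2
  · subst h2
    have := Nat.lt_two_pow_self (n := v)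
    rw [twoDefect_two]
    omega
  · rw [twoDefect_of_ne h2]
    have h3 : 3 ≤ p := lt_of_le_of_ne hp.two_le (Ne.symm h2)
    have h4 : 3 ^ v ≤ k := (Nat.pow_le_pow_left h3 v).trans h1
    rcases Nat.eq_zero_or_pos v with h5 | h5
    · omega
    · have : 1 + v * 2 ≤ 3 ^ v := by
        have := one_add_mul_le_pow (R := ℤ) (a := 2) (by norm_num) v
        have h : (1 + v * 2 : ℤ) ≤ 3 ^ v := by simpa using this
        exact_mod_cast h
      omega

theorem padicValNat_add_three_le {p k : ℕ} (hp : p.Prime) (hk : 4 ≤ k) :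
    padicValNat p k + 3 ≤ k + twoDefect p := by
  have h1 : p ^ padicValNat p k ≤ k := Nat.le_of_dvd (by omega) pow_padicValNat_dvd
  set v := padicValNat p k
  by_cases h2 : p = 2
  · subst h2
    rw [twoDefect_two]
    rcases Nat.lt_or_ge v 2 with h5 | h5
    · omega
    · obtain ⟨w, hw⟩ := Nat.exists_eq_add_of_le h5
      have := Nat.lt_two_pow_self (n := w)
      rw [hw, pow_add] at h1
      omega
  · rw [twoDefect_of_ne h2]
    have h3 : 3 ≤ p := lt_of_le_of_ne hp.two_le (Ne.symm h2)
    have h4 : 3 ^ v ≤ k := (Nat.pow_le_pow_left h3 v).trans h1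
    have : 1 + v * 2 ≤ 3 ^ v := by
      have := one_add_mul_le_pow (R := ℤ) (a := 2) (by norm_num) v
      have h : (1 + v * 2 : ℤ) ≤ 3 ^ v := by simpa using this
      exact_mod_cast h
    omega

theorem Int.pow_dvd_of_pow_dvd_mul {p : ℕ} (hp : p.Prime) {A B : ℕ} {x y : ℤ}
    (h : (p : ℤ) ^ (A + B) ∣ x * y) (hx : ¬ (p : ℤ) ^ (B + 1) ∣ x) : (p : ℤ) ^ A ∣ y := by
  have hp' : Prime (p : ℤ) := Nat.prime_iff_prime_int.mp hp
  by_contra hy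
  have h1 := emultiplicity_lt_iff_not_dvd.mpr hx
  have h2 := emultiplicity_lt_iff_not_dvd.mpr hy
  have h3 := pow_dvd_iff_le_emultiplicity.mp h
  rw [emultiplicity_mul hp'] at h3
  have h4 : emultiplicity (p : ℤ) x ≤ B := by
    have : emultiplicity (p : ℤ) x < (B : ℕ∞) + 1 := by exact_mod_cast h1
    exact Order.le_of_lt_add_one this
  lift emultiplicity (p : ℤ) x to ℕ using ne_top_of_lt h1 with u
  lift emultiplicity (p : ℤ) y to ℕ using ne_top_of_lt h2 with w
  norm_cast at *
  omega

/-- From `k * i.choose k = i * (i - 1).choose (k - 1)`, a binomial coefficient inherits the factor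
`p ^ e` of `i` up to the valuation of `k`. -/
theorem pow_dvd_choose_mul_pow {p m e i k : ℕ} (hp : p.Prime) (hk : 1 ≤ k) {n : ℤ}
    (hn : (p : ℤ) ^ m ∣ n) (hi : p ^ e ∣ i) :
    (p : ℤ) ^ (e + k * m - padicValNat p k) ∣ (i.choose k : ℤ) * n ^ k := by
  obtain ⟨k, rfl⟩ := Nat.exists_eq_add_of_le' hk
  by_cases hle : padicValNat p (k + 1) ≤ e + (k + 1) * m
  swap
  · rw [Nat.sub_eq_zero_of_le (by omega), pow_zero]; exact one_dvd _
  rcases i with _ | i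
  · simp
  have h1 := Nat.add_one_mul_choose_eq i k
  refine Int.pow_dvd_of_pow_dvd_mul hp (B := padicValNat p (k + 1)) (x := ((k + 1 : ℕ) : ℤ)) ?_ ?_
  · rw [Nat.sub_add_cancel hle, pow_add, mul_comm (k + 1) m, pow_mul]
    have h2 : ((k + 1 : ℕ) : ℤ) * (((i + 1).choose (k + 1) : ℤ) * n ^ (k + 1)) =
        (((i + 1 : ℕ) : ℤ) * n ^ (k + 1)) * (i.choose k : ℤ) := by
      have h3 : (((i + 1 : ℕ) : ℤ)) * (i.choose k : ℤ) =
        ((i + 1).choose (k + 1) : ℤ) * ((k + 1 : ℕ) : ℤ) := by exact_mod_cast h1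
      linear_combination (- n ^ (k + 1)) * h3
    rw [h2]
    exact Dvd.dvd.mul_right (mul_dvd_mul (by exact_mod_cast hi) (pow_dvd_pow_of_dvd hn _)) _
  · intro h
    have := Fact.mk hp
    exact pow_succ_padicValNat_not_dvd (p := p) (Nat.succ_ne_zero k) (by exact_mod_cast h)

/-- The difference is the part of the binomial expansion of `(1 + (α - 1)) ^ i` of degree at least
two, and the quadratic term is the worst one; for `p = 2` its denominator costs one factor. -/
theorem pow_dvd_pow_sub_one_sub {p m e i : ℕ} (hp : p.Prime) (hm : 1 ≤ m) {α : ℤ}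
    (hn : (p : ℤ) ^ m ∣ α - 1) (hi : p ^ e ∣ i) :
    (p : ℤ) ^ (e + 2 * m - twoDefect p) ∣ α ^ i - 1 - i * (α - 1) := by
  rcases Nat.lt_or_ge i 2 with h | h
  · interval_cases i <;> simp
  have h1 : α ^ i = ∑ k ∈ Finset.range (i + 1), (α - 1) ^ k * 1 ^ (i - k) * (i.choose k : ℤ) := by
    rw [← add_pow, sub_add_cancel]
  obtain ⟨i, rfl⟩ := Nat.exists_eq_add_of_le' h
  rw [h1, Finset.sum_range_succ', Finset.sum_range_succ']
  have : ∀ x y z : ℤ, z = y → x + y + (α - 1) ^ 0 * 1 ^ (i + 2 - 0) * ((i + 2).choose 0 : ℤ) - 1 -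
      z = x := by intro x y z hz; rw [hz]; simp
  rw [this _ _ _ (by simp; ring)]
  refine Finset.dvd_sum fun k _ => ?_
  have h2 := pow_dvd_choose_mul_pow hp (k := k + 1 + 1) (by omega) hn hi
  have h3 := padicValNat_add_two_le hp (k := k + 1 + 1) (by omega)
  have h4 : e + 2 * m - twoDefect p ≤ e + (k + 1 + 1) * m - padicValNat p (k + 1 + 1) := by
    have : (k + 1 + 1) * m = 2 * m + k * m := by ring
    have : k ≤ k * m := Nat.le_mul_of_pos_right k hm
    omega
  rw [one_pow, mul_one, mul_comm (_ ^ _)]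
  exact (pow_dvd_pow _ h4).trans h2

theorem pow_dvd_powSum_sub {p m e i : ℕ} (hp : p.Prime) (hm : 1 ≤ m) {α : ℤ}
    (hn : (p : ℤ) ^ m ∣ α - 1) (hn' : ¬ (p : ℤ) ^ (m + 1) ∣ α - 1) (hi : p ^ e ∣ i) :
    (p : ℤ) ^ (e + m - twoDefect p) ∣ powSum α i - i := by
  have h1 := twoDefect_le_one p
  refine Int.pow_dvd_of_pow_dvd_mul hp (B := m) (x := α - 1) ?_ hn'
  have h2 : (α - 1) * (powSum α i - i) =
      α * (α ^ i - 1 - i * (α - 1)) + i * ((α - 1) * (α - 1)) := by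
    rw [mul_sub, mul_powSum]; ring
  have h3 : e + m - twoDefect p + m = e + 2 * m - twoDefect p := by omega
  rw [h2, h3]
  refine dvd_add (Dvd.dvd.mul_left (pow_dvd_pow_sub_one_sub hp hm hn hi) _) ?_
  refine (pow_dvd_pow _ (show e + 2 * m - twoDefect p ≤ e + (m + m) by omega)).trans ?_
  rw [pow_add, pow_add]
  exact mul_dvd_mul (by exact_mod_cast hi) (mul_dvd_mul hn hn)

/-- The converse of the lifting of exponents, with a small loss for the prime `2`. -/
theorem pow_dvd_of_pow_dvd_pow_sub_one {p m e i : ℕ} (hp : p.Prime) (hm : twoDefect p < m) {α : ℤ}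
    (hn : (p : ℤ) ^ m ∣ α - 1) (hn' : ¬ (p : ℤ) ^ (m + 1) ∣ α - 1)
    (h : (p : ℤ) ^ (e + m) ∣ α ^ i - 1) : p ^ e ∣ i := by
  induction e with
  | zero => simp
  | succ e ih =>
    have h1 := ih ((pow_dvd_pow _ (by omega)).trans h)
    have h2 := pow_dvd_pow_sub_one_sub hp (by omega) hn h1
    have h3 : (p : ℤ) ^ (e + 1 + m) ∣ (α - 1) * i := by
      have := dvd_sub h ((pow_dvd_pow _ (show e + 1 + m ≤ e + 2 * m - twoDefect p by omega)).trans h2)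
      rwa [show α ^ i - 1 - (α ^ i - 1 - i * (α - 1)) = (α - 1) * i by ring] at this
    exact_mod_cast Int.pow_dvd_of_pow_dvd_mul hp h3 hn'

theorem pow_dvd_pow_sub_one {p m e i : ℕ} {α : ℤ} (hm : 1 ≤ m) (hn : (p : ℤ) ^ m ∣ α - 1)
    (hi : p ^ e ∣ i) (hp : p.Prime) : (p : ℤ) ^ (e + m) ∣ α ^ i - 1 := by
  have h1 := pow_dvd_pow_sub_one_sub hp hm hn hi
  have h2 := twoDefect_le_one p
  have h3 : (p : ℤ) ^ (e + m) ∣ (i : ℤ) * (α - 1) := by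
    rw [pow_add]; exact mul_dvd_mul (by exact_mod_cast hi) hn
  have := dvd_add ((pow_dvd_pow _ (show e + m ≤ e + 2 * m - twoDefect p by omega)).trans h1) h3
  simpa using this

theorem Int.natCast_dvd_of_forall_prime_pow {e : ℕ} {x : ℤ}
    (h : ∀ p k : ℕ, p.Prime → p ^ k ∣ e → (p : ℤ) ^ k ∣ x) : (e : ℤ) ∣ x := by
  rw [Int.natCast_dvd, Nat.dvd_iff_prime_pow_dvd_dvd]
  intro p k hp hk
  have := h p k hp hk
  rw [← Int.natCast_dvd]
  exact_mod_cast this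

/-- It suffices to treat each prime power `r ^ t` dividing `e`. If `r ∣ α - 1`, lifting of exponents
applies, because `r ≠ q` and so `r ^ t ∣ e / q`. Otherwise `r ≤ q` by maximality of `q`. The order
of `α` modulo `r ^ t` divides both `e` and `r ^ (t - 1) * (r - 1)`, and the latter contains fewer
factors `q` than `e` does, so that order divides `e / q`. -/
theorem dvd_pow_div_sub_one {α : ℤ} {e q : ℕ} (he : 0 < e) (hα : (e : ℤ) ∣ α ^ e - 1)
    (hq : q.Prime) (hqe : q ∣ e) (hqα : ¬ (q : ℤ) ∣ α - 1)
    (hmax : ∀ r : ℕ, r.Prime → r ∣ e → q < r → (r : ℤ) ∣ α - 1) :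
    (e : ℤ) ∣ α ^ (e / q) - 1 := by
  refine Int.natCast_dvd_of_forall_prime_pow fun r t hr ht => ?_
  rcases Nat.eq_zero_or_pos t with rfl | ht0
  · simp
  have hre : r ∣ e := (dvd_pow_self r ht0.ne').trans ht
  by_cases hrα : (r : ℤ) ∣ α - 1
  · have hrq : r ≠ q := by rintro rfl; exact hqα hrα
    have h1 : r ^ t ∣ e / q := by
      refine (Nat.Coprime.dvd_of_dvd_mul_right (n := q) ?_ ?_)
      · exact Nat.Coprime.pow_left _ ((Nat.coprime_primes hr hq).mpr hrq)
      · rwa [Nat.div_mul_cancel hqe]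
    exact (pow_dvd_pow _ (by omega)).trans
      (pow_dvd_pow_sub_one (m := 1) le_rfl (by simpa using hrα) h1 hr)
  · have hrq : r ≤ q := by
      by_contra h; exact hrα (hmax r hr hre (by omega))
    obtain ⟨v, e', hv, he'⟩ := Nat.exists_eq_pow_mul_and_not_dvd he.ne' q hq.ne_one
    have hcop : IsCoprime α ((r ^ t : ℕ) : ℤ) := by
      have h1 : ((r ^ t : ℕ) : ℤ) ∣ α ^ e - 1 := (Int.natCast_dvd_natCast.mpr ht).trans hα
      obtain ⟨w, hw⟩ := h1
      refine ⟨α ^ (e - 1), -w, ?_⟩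
      rw [← pow_succ, Nat.sub_add_cancel he]
      linarith
    have h2 : ((r ^ t : ℕ) : ℤ) ∣ α ^ (r ^ t).totient - 1 := by
      obtain ⟨x, y, hxy⟩ := hcop
      have hu : IsUnit (α : ZMod (r ^ t)) := by
        refine IsUnit.of_mul_eq_one (x : ZMod (r ^ t)) ?_
        have h := congrArg (Int.cast : ℤ → ZMod (r ^ t)) hxy
        simp only [Int.cast_add, Int.cast_mul, Int.cast_natCast, ZMod.natCast_self, mul_zero,
          add_zero, Int.cast_one] at h
        rw [mul_comm, h]
      obtain ⟨u, hu⟩ := hu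
      have h := ZMod.pow_totient u
      rw [← ZMod.intCast_zmod_eq_zero_iff_dvd]
      rw [Int.cast_sub, Int.cast_pow, ← hu, ← Units.val_pow_eq_pow_val, h]
      simp
    have h3 : ((r ^ t : ℕ) : ℤ) ∣ α ^ (Nat.gcd e (r ^ t).totient) - 1 := by
      have h4 : ((r ^ t : ℕ) : ℤ) ∣ α ^ e - 1 := (Int.natCast_dvd_natCast.mpr ht).trans hα
      rw [← ZMod.intCast_zmod_eq_zero_iff_dvd] at h2 h4 ⊢
      push_cast at h2 h4 ⊢
      rw [sub_eq_zero] at h2 h4 ⊢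
      rw [← orderOf_dvd_iff_pow_eq_one] at *
      exact Nat.dvd_gcd h4 h2
    have h5 : Nat.gcd e (r ^ t).totient ∣ e / q := by
      obtain ⟨k, hk⟩ := Nat.gcd_dvd_left e (r ^ t).totient
      have hqk : q ∣ k := by
        by_contra hqk
        have h6 : q ^ v ∣ Nat.gcd e (r ^ t).totient := by
          refine Nat.Coprime.dvd_of_dvd_mul_right (n := k) ?_ ?_
          · exact Nat.Coprime.pow_left _ ((Nat.Prime.coprime_iff_not_dvd hq).mpr hqk)
          · rw [← hk]; exact ⟨e', he'⟩
        have h7 : q ^ v ∣ (r ^ t).totient := h6.trans (Nat.gcd_dvd_right _ _)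
        rw [Nat.totient_prime_pow hr ht0] at h7
        have hv0 : v ≠ 0 := by
          rintro rfl
          rw [pow_zero, one_mul] at he'
          exact hv (he' ▸ hqe)
        have hlt : ¬ q ∣ r - 1 := by
          intro h
          have := Nat.le_of_dvd (Nat.sub_pos_of_lt hr.one_lt) h
          have := hr.one_lt
          omega
        rcases Nat.eq_or_lt_of_le hrq with rfl | hlt'
        · have h8 : r ^ v ∣ r ^ (t - 1) :=
            Nat.Coprime.dvd_of_dvd_mul_right
              (Nat.Coprime.pow_left _ ((Nat.Prime.coprime_iff_not_dvd hq).mpr hlt)) h7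
          have h9 := (Nat.pow_dvd_pow_iff_le_right hr.one_lt).mp h8
          have h10 : r ^ t ∣ r ^ v := by
            rw [he'] at ht
            exact Nat.Coprime.dvd_of_dvd_mul_right
              (Nat.Coprime.pow_left _ ((Nat.Prime.coprime_iff_not_dvd hq).mpr hv)) ht
          have h11 := (Nat.pow_dvd_pow_iff_le_right hr.one_lt).mp h10
          omega
        · have h8 : q ∣ r ^ (t - 1) * (r - 1) := (dvd_pow_self q hv0).trans h7
          rcases (Nat.Prime.dvd_mul hq).mp h8 with h9 | h9
          · have := (Nat.prime_dvd_prime_iff_eq hq hr).mp (hq.dvd_of_dvd_pow h9)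
            omega
          · exact hlt h9
      obtain ⟨k', rfl⟩ := hqk
      refine ⟨k', ?_⟩
      rw [Nat.div_eq_of_eq_mul_left hq.pos]
      rw [mul_assoc, mul_comm k' q]; exact hk
    obtain ⟨w, hw⟩ := h5
    rw [hw, pow_mul]
    have h4 := sub_dvd_pow_sub_pow (α ^ Nat.gcd e (r ^ t).totient) 1 w
    rw [one_pow] at h4
    exact_mod_cast h3.trans h4

end NumberTheory

/-! ### Removing the primes that do not divide `α - 1` from the orders of the generators. -/

namespace MacdonaldTriple

variable {T : Type*} [Group T] {α : ℤ} {a b c : T}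

theorem zpow_eq_one_of_isCoprime {x y : ℤ} {g : T} (hx : g ^ x = 1) (hy : g ^ y = 1)
    (h : IsCoprime x y) : g = 1 := by
  obtain ⟨u, v, huv⟩ := h
  rw [← zpow_one g, ← huv, zpow_add, mul_comm u, mul_comm v, zpow_mul, zpow_mul, hx, hy]
  simp

theorem commute_pow_left (h : MacdonaldTriple α a b c) {e i : ℕ} (ha : a ^ e = 1)
    (hi : (e : ℤ) ∣ α ^ i - 1) : Commute (c ^ i) a := by
  have h1 := h.zpow_left_mul_pow 1 i
  obtain ⟨t, ht⟩ := hi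
  rw [zpow_one, mul_one, show α ^ i = 1 + e * t by linarith, zpow_add, zpow_mul, zpow_natCast, ha,
    one_zpow, zpow_one, mul_one] at h1
  exact h1.symm

theorem commute_pow_right (h : MacdonaldTriple α a b c) {e i : ℕ} (hb : b ^ e = 1)
    (hi : (e : ℤ) ∣ α ^ i - 1) : Commute (c ^ i) b := by
  have := h.swap.commute_pow_left hb hi
  rw [inv_pow] at this
  exact Commute.inv_left_iff.mp this

/-- With `n` the order of `a`, the formula for `a ^ n * b` gives `c ^ n * a ^ powSum α n = 1`, so `a
^ powSum α n` commutes with `c`; now `(α - 1) * powSum α n = α * (α ^ n - 1)`. -/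
theorem natCast_orderOf_dvd_pow_sub_one (h : MacdonaldTriple α a b c) :
    (orderOf a : ℤ) ∣ α ^ orderOf a - 1 := by
  rw [orderOf_dvd_iff_zpow_eq_one]
  refine h.zpow_left_eq_one_of_mul ?_
  rw [← mul_powSum]
  refine h.zpow_left_eq_one_of_commute_comm ?_
  have h1 := h.pow_left_mul_right (orderOf a)
  rw [pow_orderOf_eq_one, one_mul, mul_assoc, eq_comm, mul_eq_left] at h1
  rw [eq_inv_of_mul_eq_one_right h1]
  exact ((Commute.refl c).pow_left _).inv_left

/-- With `i = e / q`, the element `c ^ i` commutes with both generators. Conjugating `a ^ (i * (α -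
1))` by `b` gives a power of `c ^ i`, because the factor in `a` dies; so that element commutes with
`b` and `a ^ i` is killed by `(α - 1) ^ 2`. It is also killed by `q`, which is coprime to `α - 1`.
-/
theorem pow_left_div_eq_one (h : MacdonaldTriple α a b c) {e q : ℕ} (ha : a ^ e = 1)
    (hb : b ^ e = 1) (hq : q.Prime) (hqe : q ∣ e) (hqα : ¬ (q : ℤ) ∣ α - 1)
    (hi : (e : ℤ) ∣ α ^ (e / q) - 1) : a ^ (e / q) = 1 := by
  set i := e / q with hi_def
  have hca := h.commute_pow_left ha hi
  have hcb := h.commute_pow_right hb hi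
  have h1 := h.pow_left_mul_right i
  have h2 : a ^ ((α - 1) * powSum α i) = 1 := by
    obtain ⟨t, ht⟩ := hi
    rw [mul_powSum, ht, mul_left_comm, zpow_mul, zpow_natCast, ha, one_zpow]
  have h3 : b⁻¹ * a ^ i * b = c ^ i * a ^ powSum α i := by rw [mul_assoc, h1]; group
  have h4 : b⁻¹ * a ^ (i * (α - 1)) * b = (c ^ i) ^ (α - 1) := by
    have h5 : b⁻¹ * (a ^ i) ^ (α - 1) * b = (b⁻¹ * a ^ i * b) ^ (α - 1) := by
      simpa using (conj_zpow (a := b⁻¹) (b := a ^ i) (i := α - 1)).symm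
    rw [zpow_mul, zpow_natCast, h5, h3, (hca.zpow_right _).mul_zpow, ← zpow_mul a,
      mul_comm (powSum α i), h2, mul_one]
  have h5 : Commute (a ^ (i * (α - 1))) b := by
    have h6 : b⁻¹ * a ^ (i * (α - 1)) * b * b = b * (b⁻¹ * a ^ (i * (α - 1)) * b) := by
      rw [h4]; exact hcb.zpow_left _
    have h7 : a ^ (i * (α - 1)) * b = b * (b⁻¹ * a ^ (i * (α - 1)) * b) := by group
    have h8 : a ^ (i * (α - 1)) * b * b = b * (a ^ (i * (α - 1)) * b) := by
      rw [h7, mul_assoc b, h6]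
    rw [← mul_assoc] at h8
    exact mul_right_cancel h8
  have h6 := h.zpow_left_eq_one_of_commute_right h5
  have h7 : (a ^ i) ^ ((α - 1) ^ 2) = 1 := by
    rw [← zpow_natCast, ← zpow_mul, ← h6]; ring_nf
  refine zpow_eq_one_of_isCoprime h7 (y := (q : ℤ)) ?_ ?_
  · rw [zpow_natCast, ← pow_mul, hi_def, Nat.div_mul_cancel hqe, ha]
  · refine IsCoprime.pow_left ?_
    rw [isCoprime_comm]
    exact (Prime.coprime_iff_not_dvd (Nat.prime_iff_prime_int.mp hq)).mpr hqα

/-- Primes that do not divide `α - 1` may be removed from a common exponent of the generators. -/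
theorem exists_exponent_aux (h : MacdonaldTriple α a b c) (e : ℕ) (he : 0 < e)
    (hα : (e : ℤ) ∣ α ^ e - 1) (ha : a ^ e = 1) (hb : b ^ e = 1) :
    ∃ e' : ℕ, 0 < e' ∧ (∀ q : ℕ, q.Prime → q ∣ e' → (q : ℤ) ∣ α - 1) ∧ a ^ e' = 1 ∧
      b ^ e' = 1 := by
  induction e using Nat.strong_induction_on with
  | _ e ih =>
    by_cases hs : (e.primeFactors.filter fun q : ℕ => ¬ (q : ℤ) ∣ α - 1).Nonempty
    · have h1 := Finset.max'_mem _ hs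
      have h2 := fun r hr => Finset.le_max' (e.primeFactors.filter fun q : ℕ => ¬ (q : ℤ) ∣ α - 1) r hr
      set q := Finset.max' _ hs
      simp only [Finset.mem_filter, Nat.mem_primeFactors] at h1 h2
      obtain ⟨⟨hq, hqe, -⟩, hqα⟩ := h1
      have h3 := dvd_pow_div_sub_one he hα hq hqe hqα (fun r hr hre hqr => by
        by_contra hrα
        exact absurd (h2 r ⟨⟨hr, hre, he.ne'⟩, hrα⟩) (by omega))
      refine ih (e / q) (Nat.div_lt_self he hq.one_lt)
        (Nat.div_pos (Nat.le_of_dvd he hqe) hq.pos) ?_ ?_ ?_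
      · exact (Int.natCast_dvd_natCast.mpr (Nat.div_dvd_of_dvd hqe)).trans h3
      · exact h.pow_left_div_eq_one ha hb hq hqe hqα h3
      · exact h.swap.pow_left_div_eq_one hb ha hq hqe hqα h3
    · refine ⟨e, he, fun q hq hqe => ?_, ha, hb⟩
      by_contra hqα
      exact hs ⟨q, by simp [hq, hqe, he.ne', hqα]⟩

theorem exists_exponent (h : MacdonaldTriple α a b c) (h0 : α ≠ 0) (h1 : α ≠ 1) :
    ∃ e : ℕ, 0 < e ∧ (∀ q : ℕ, q.Prime → q ∣ e → (q : ℤ) ∣ α - 1) ∧ a ^ e = 1 ∧ b ^ e = 1 := by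
  obtain ⟨e₁, he₁, -, ha⟩ := h.exists_pow_left_eq_one h0 h1
  obtain ⟨e₂, he₂, -, hb⟩ := h.swap.exists_pow_left_eq_one h0 h1
  have ha' := orderOf_pos_iff.mpr (isOfFinOrder_iff_pow_eq_one.mpr ⟨e₁, he₁, ha⟩)
  have hb' := orderOf_pos_iff.mpr (isOfFinOrder_iff_pow_eq_one.mpr ⟨e₂, he₂, hb⟩)
  have hsub : ∀ x y : ℕ, x ∣ y → α ^ x - 1 ∣ α ^ y - 1 := by
    rintro x _ ⟨w, rfl⟩
    have := sub_dvd_pow_sub_pow (α ^ x) 1 w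
    rwa [one_pow, ← pow_mul] at this
  refine h.exists_exponent_aux (Nat.lcm (orderOf a) (orderOf b)) (Nat.lcm_pos ha' hb') ?_
    (orderOf_dvd_iff_pow_eq_one.mp (Nat.dvd_lcm_left _ _))
    (orderOf_dvd_iff_pow_eq_one.mp (Nat.dvd_lcm_right _ _))
  have h3 : ((Nat.lcm (orderOf a) (orderOf b) : ℕ) : ℤ) =
      lcm (orderOf a : ℤ) (orderOf b : ℤ) := by
    rw [← Int.coe_lcm, Int.lcm_natCast_natCast]
  rw [h3]
  refine lcm_dvd ?_ ?_
  · exact h.natCast_orderOf_dvd_pow_sub_one.trans (hsub _ _ (Nat.dvd_lcm_left _ _))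
  · exact h.swap.natCast_orderOf_dvd_pow_sub_one.trans (hsub _ _ (Nat.dvd_lcm_right _ _))

end MacdonaldTriple

/-! ### Finiteness and nilpotency. -/

theorem zpow_eq_zpow_of_dvd_sub {T : Type*} [Group T] {g : T} {e : ℕ} (hg : g ^ e = 1) {x y : ℤ}
    (h : (e : ℤ) ∣ x - y) : g ^ x = g ^ y := by
  obtain ⟨t, ht⟩ := h
  rw [show x = y + e * t by linarith, zpow_add, zpow_mul, zpow_natCast, hg, one_zpow, mul_one]

theorem exists_zpow_eq_pow {T : Type*} [Group T] {g : T} {e : ℕ} (he : 0 < e) (hg : g ^ e = 1)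
    (x : ℤ) : ∃ i < e, g ^ x = g ^ i := by
  have h1 := Int.emod_nonneg x (b := e) (by omega)
  have h2 := Int.emod_lt_of_pos x (b := e) (by omega)
  refine ⟨(x % e).toNat, by omega, ?_⟩
  rw [← zpow_natCast, Int.toNat_of_nonneg h1]
  refine zpow_eq_zpow_of_dvd_sub hg ⟨x / e, ?_⟩
  linarith [Int.mul_ediv_add_emod x e]

theorem padicValInt_exact {p : ℕ} (hp : p.Prime) {n : ℤ} (hn : n ≠ 0) (hpn : (p : ℤ) ∣ n) :
    1 ≤ padicValInt p n ∧ (p : ℤ) ^ padicValInt p n ∣ n ∧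
      ¬ (p : ℤ) ^ (padicValInt p n + 1) ∣ n := by
  have := Fact.mk hp
  refine ⟨?_, padicValInt_dvd n, ?_⟩
  · have := (padicValInt_dvd_iff (p := p) 1 n).mp (by simpa using hpn)
    exact this.resolve_left hn
  · rw [padicValInt_dvd_iff]
    rintro (h | h)
    · exact hn h
    · omega

theorem isCoprime_of_forall_prime_dvd_sub_one {α : ℤ} {e : ℕ}
    (h : ∀ q : ℕ, q.Prime → q ∣ e → (q : ℤ) ∣ α - 1) : IsCoprime (e : ℤ) α := by
  rw [Int.isCoprime_iff_gcd_eq_one]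
  by_contra hne
  obtain ⟨q, hq, hqd⟩ := Nat.exists_prime_and_dvd hne
  have h1 : (q : ℤ) ∣ e := (Int.natCast_dvd_natCast.mpr hqd).trans (Int.gcd_dvd_left _ _)
  have h2 : (q : ℤ) ∣ α := (Int.natCast_dvd_natCast.mpr hqd).trans (Int.gcd_dvd_right _ _)
  have h3 := h q hq (Int.natCast_dvd_natCast.mp h1)
  have h4 : (q : ℤ) ∣ 1 := by simpa using dvd_sub h2 h3
  exact hq.one_lt.ne' (by exact_mod_cast Int.eq_one_of_dvd_one (by positivity) h4)

namespace MacdonaldTriple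

variable {T : Type*} [Group T] {α : ℤ} {a b c : T}

theorem pow_comm_mul_zpow_left (h : MacdonaldTriple α a b c) {e : ℕ} (ha : a ^ e = 1) {β : ℤ}
    (hβ : (e : ℤ) ∣ α * β - 1) (x : ℤ) (j : ℕ) : c ^ j * a ^ x = a ^ (β ^ j * x) * c ^ j := by
  rw [h.zpow_left_mul_pow, ← mul_assoc, ← mul_pow]
  congr 1
  refine zpow_eq_zpow_of_dvd_sub ha ?_
  have h1 := sub_dvd_pow_sub_pow (α * β) 1 j
  rw [one_pow] at h1
  have h2 := (hβ.trans h1).mul_right x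
  rw [← dvd_neg]
  convert h2 using 1
  ring

theorem exists_inverse_mod {e : ℕ} (he : IsCoprime (e : ℤ) α) : ∃ β : ℤ, (e : ℤ) ∣ α * β - 1 := by
  obtain ⟨u, v, huv⟩ := he
  exact ⟨v, -u, by linarith⟩

/-- The products `c ^ k * a ^ i * b ^ j` are stable under right multiplication by the generators: `b
^ j * a = a * c ^ (-j) * b ^ powSum α j`, and `c` moves left past powers of `a` thanks to an inverse
`β` of `α` modulo `e`. Inverses of the generators are positive powers. -/
theorem exists_eq_zpow_mul_zpow_mul_pow (h : MacdonaldTriple α a b c)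
    (hT : Subgroup.closure {a, b} = ⊤) {e : ℕ} (he : 0 < e) (hα : IsCoprime (e : ℤ) α)
    (ha : a ^ e = 1) (hb : b ^ e = 1) (g : T) :
    ∃ (k i : ℤ) (j : ℕ), g = c ^ k * a ^ i * b ^ j := by
  obtain ⟨β, hβ⟩ := exists_inverse_mod hα
  have mul_a : ∀ g : T, (∃ (k i : ℤ) (j : ℕ), g = c ^ k * a ^ i * b ^ j) →
      ∃ (k i : ℤ) (j : ℕ), g * a = c ^ k * a ^ i * b ^ j := by
    rintro _ ⟨k, i, j, rfl⟩
    obtain ⟨j', -, hj'⟩ := exists_zpow_eq_pow he hb (powSum α j)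
    refine ⟨k - j, β ^ j * (i + 1), j', ?_⟩
    have h1 := h.pow_comm_mul_zpow_left ha hβ (i + 1) j
    rw [← hj', mul_assoc, h.pow_right_mul_left]
    have h2 : a ^ (β ^ j * (i + 1)) = c ^ j * a ^ (i + 1) * (c ^ j)⁻¹ := by
      rw [h1, mul_inv_cancel_right]
    rw [h2, zpow_sub, zpow_natCast, zpow_add, zpow_one]
    group
  have mul_b : ∀ g : T, (∃ (k i : ℤ) (j : ℕ), g = c ^ k * a ^ i * b ^ j) →
      ∃ (k i : ℤ) (j : ℕ), g * b = c ^ k * a ^ i * b ^ j := by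
    rintro _ ⟨k, i, j, rfl⟩
    exact ⟨k, i, j + 1, by rw [mul_assoc, ← pow_succ]⟩
  have mul_pow : ∀ x : T, (∀ g : T, (∃ (k i : ℤ) (j : ℕ), g = c ^ k * a ^ i * b ^ j) →
      ∃ (k i : ℤ) (j : ℕ), g * x = c ^ k * a ^ i * b ^ j) → ∀ (N : ℕ) (g : T),
      (∃ (k i : ℤ) (j : ℕ), g = c ^ k * a ^ i * b ^ j) →
      ∃ (k i : ℤ) (j : ℕ), g * x ^ N = c ^ k * a ^ i * b ^ j := by
    intro x hx N
    induction N with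
    | zero => intro g hg; simpa using hg
    | succ N ih => intro g hg; rw [pow_succ, ← mul_assoc]; exact hx _ (ih g hg)
  have inv_eq : ∀ x : T, x ^ e = 1 → x⁻¹ = x ^ (e - 1) := fun x hx => by
    rw [inv_eq_iff_mul_eq_one, ← pow_succ', Nat.sub_add_cancel he, hx]
  have hg : g ∈ Subgroup.closure {a, b} := hT ▸ Subgroup.mem_top g
  induction hg using Subgroup.closure_induction_right with
  | one => exact ⟨0, 0, 0, by simp⟩
  | mul_right x _ y hy ih =>
    rcases hy with rfl | rfl
    · exact mul_a _ ih
    · exact mul_b _ ih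
  | mul_inv_cancel x _ y hy ih =>
    rcases hy with rfl | rfl
    · rw [inv_eq _ ha]; exact mul_pow _ mul_a _ _ ih
    · rw [inv_eq _ hb]; exact mul_pow _ mul_b _ _ ih

theorem comm_pow_mul_self_eq_one (h : MacdonaldTriple α a b c) {e : ℕ} (ha : a ^ e = 1) :
    c ^ (e * e) = 1 := by
  have h1 := h.pow_left_mul_right e
  rw [ha, one_mul, mul_assoc, eq_comm, mul_eq_left] at h1
  rw [pow_mul, eq_inv_of_mul_eq_one_left h1, inv_pow, ← zpow_natCast, ← zpow_mul, mul_comm,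
    zpow_mul, zpow_natCast, ha, one_zpow, inv_one]

theorem exists_eq_pow_mul_pow_mul_pow (h : MacdonaldTriple α a b c)
    (hT : Subgroup.closure {a, b} = ⊤) {e : ℕ} (he : 0 < e) (hα : IsCoprime (e : ℤ) α)
    (ha : a ^ e = 1) (hb : b ^ e = 1) (g : T) :
    ∃ i < e, ∃ j < e, ∃ k < e * e, g = a ^ i * b ^ j * c ^ k := by
  -- Using the swapped triple on `g⁻¹` and then inverting reverses the order of the factors to `a`,
  -- `b`, `c`.
  obtain ⟨k, i, j, hg⟩ := h.swap.exists_eq_zpow_mul_zpow_mul_pow (by rwa [Set.pair_comm]) he hα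
    hb ha g⁻¹
  obtain ⟨i', hi', hi⟩ := exists_zpow_eq_pow he ha (-(j : ℤ))
  obtain ⟨j', hj', hj⟩ := exists_zpow_eq_pow he hb (-i)
  obtain ⟨k', hk', hk⟩ := exists_zpow_eq_pow (Nat.mul_pos he he) (h.comm_pow_mul_self_eq_one ha) k
  refine ⟨i', hi', j', hj', k', hk', ?_⟩
  rw [← hi, ← hj, ← hk, ← inv_inv g, hg]
  group

theorem finite (h : MacdonaldTriple α a b c) (hT : Subgroup.closure {a, b} = ⊤) {e : ℕ}
    (he : 0 < e) (hα : IsCoprime (e : ℤ) α) (ha : a ^ e = 1) (hb : b ^ e = 1) : Finite T := by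
  refine Finite.of_surjective (fun t : Fin e × Fin e × Fin (e * e) =>
    a ^ (t.1 : ℕ) * b ^ (t.2.1 : ℕ) * c ^ (t.2.2 : ℕ)) fun g => ?_
  obtain ⟨i, hi, j, hj, k, hk, rfl⟩ := h.exists_eq_pow_mul_pow_mul_pow hT he hα ha hb g
  exact ⟨(⟨i, hi⟩, ⟨j, hj⟩, ⟨k, hk⟩), rfl⟩

/-- With `i = e / q` and `c ^ i = 1` one has `a ^ i * b = b * a ^ powSum α i`, so `a ^ powSum α i =
a ^ i` is needed. For odd `q`, `powSum α i ≡ i` modulo `e`. For `q = 2` this is known only modulo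
`i`, so `a ^ powSum α i` is `a ^ i` or `1`, and in the second case `a ^ i` is itself trivial. -/
theorem commute_pow_left_div (h : MacdonaldTriple α a b c) {e q : ℕ} (hα1 : α ≠ 1)
    (ha : a ^ e = 1) (hq : q.Prime) (hqe : q ∣ e)
    (hprime : ∀ r : ℕ, r.Prime → r ∣ e → (r : ℤ) ∣ α - 1) (hc : c ^ (e / q) = 1) :
    Commute (a ^ (e / q)) b := by
  have h1 := h.pow_left_mul_right (e / q)
  set i := e / q with hi_def
  have hiq : i * q = e := Nat.div_mul_cancel hqe
  rw [hc, mul_one] at h1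
  suffices h2 : a ^ powSum α i = a ^ i by rw [Commute, SemiconjBy, h1, h2]
  have hn : α - 1 ≠ 0 := sub_ne_zero.mpr hα1
  by_cases hq2 : q = 2
  · have h3 : (i : ℤ) ∣ powSum α i - i := by
      refine Int.natCast_dvd_of_forall_prime_pow fun r t hr ht => ?_
      rcases Nat.eq_zero_or_pos t with rfl | ht0
      · simp
      have hre : r ∣ e := (dvd_pow_self r ht0.ne').trans (ht.trans ⟨q, hiq.symm⟩)
      obtain ⟨hm, hd, hd'⟩ := padicValInt_exact hr hn (hprime r hr hre)
      have := twoDefect_le_one r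
      exact (pow_dvd_pow _ (by omega)).trans (pow_dvd_powSum_sub hr hm hd hd' ht)
    obtain ⟨w, hw⟩ := h3
    have h4 : (a ^ i) ^ 2 = 1 := by rw [← pow_mul, ← hq2, hiq, ha]
    have h5 : a ^ powSum α i = a ^ i * (a ^ i) ^ w := by
      rw [← zpow_natCast, ← zpow_mul, ← zpow_add]; congr 1; linarith
    obtain ⟨u, hu, hu'⟩ := exists_zpow_eq_pow (by norm_num) h4 w
    interval_cases u
    · rw [h5, hu', pow_zero, mul_one]
    · rw [pow_one] at hu'
      rw [hu', ← pow_two, h4] at h5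
      rw [h5, mul_one, mul_eq_right] at h1
      rw [h5, h1]
  · have h3 : (e : ℤ) ∣ powSum α i - i := by
      refine Int.natCast_dvd_of_forall_prime_pow fun r t hr ht => ?_
      rcases Nat.eq_zero_or_pos t with rfl | ht0
      · simp
      have hre : r ∣ e := (dvd_pow_self r ht0.ne').trans ht
      obtain ⟨hm, hd, hd'⟩ := padicValInt_exact hr hn (hprime r hr hre)
      by_cases hrq : r = q
      · subst hrq
        have h4 : r ^ (t - 1) ∣ i := by
          rw [← hiq, ← Nat.sub_add_cancel ht0, pow_succ] at ht
          exact Nat.dvd_of_mul_dvd_mul_right hr.pos ht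
        have := pow_dvd_powSum_sub hr hm hd hd' h4
        rw [twoDefect_of_ne hq2] at this
        exact (pow_dvd_pow _ (by omega)).trans this
      · have h4 : r ^ t ∣ i := by
          rw [← hiq] at ht
          exact Nat.Coprime.dvd_of_dvd_mul_right
            (Nat.Coprime.pow_left _ ((Nat.coprime_primes hr hq).mpr hrq)) ht
        have := twoDefect_le_one r
        exact (pow_dvd_pow _ (by omega)).trans (pow_dvd_powSum_sub hr hm hd hd' h4)
    rw [zpow_eq_zpow_of_dvd_sub ha h3, zpow_natCast]

theorem closure_map_eq_top {S : Type*} [Group S] (hT : Subgroup.closure {a, b} = ⊤) (f : T →* S)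
    (hf : Function.Surjective f) : Subgroup.closure {f a, f b} = ⊤ := by
  have := MonoidHom.map_closure f {a, b}
  rw [hT, Set.image_pair, Subgroup.map_top_of_surjective f hf] at this
  exact this.symm

theorem mem_center_of_commute (hT : Subgroup.closure {a, b} = ⊤) {z : T} (ha : Commute z a)
    (hb : Commute z b) : z ∈ Subgroup.center T := by
  rw [Subgroup.mem_center_iff]
  intro g
  have hg : g ∈ Subgroup.closure {a, b} := hT ▸ Subgroup.mem_top g
  have h1 : Subgroup.closure {a, b} ≤ Subgroup.centralizer {z} := by
    rw [Subgroup.closure_le]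
    rintro x (rfl | rfl) <;> simp only [SetLike.mem_coe, Subgroup.mem_centralizer_singleton_iff]
    · exact ha.symm.eq
    · exact hb.symm.eq
  exact Subgroup.mem_centralizer_singleton_iff.mp (h1 hg)

universe u

/-- Two central quotients lower the exponent from `e` to `e / q`: `c ^ (e / q)` is central, and once
it is factored out so are `a ^ (e / q)` and `b ^ (e / q)`. -/
theorem isNilpotent_of_exponent (hα1 : α ≠ 1) (e : ℕ) : ∀ {T : Type u} [Group T] {a b c : T},
    MacdonaldTriple α a b c → Subgroup.closure {a, b} = ⊤ → 0 < e →
    (∀ r : ℕ, r.Prime → r ∣ e → (r : ℤ) ∣ α - 1) → a ^ e = 1 → b ^ e = 1 →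
    Group.IsNilpotent T := by
  induction e using Nat.strong_induction_on with
  | _ e ih =>
    intro T _ a b c h hT he hprime ha hb
    by_cases he1 : e = 1
    · subst he1
      rw [pow_one] at ha hb
      have : Subsingleton T := by
        rw [ha, hb, Set.pair_eq_singleton, Subgroup.closure_singleton_one] at hT
        exact (Subgroup.subsingleton_iff (G := T)).mp (subsingleton_of_bot_eq_top hT)
      infer_instance
    have hq := Nat.minFac_prime he1
    have hqe := Nat.minFac_dvd e
    set q := e.minFac
    have hie : e / q ∣ e := Nat.div_dvd_of_dvd hqe
    have hdvd : (e : ℤ) ∣ α ^ (e / q) - 1 := by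
      refine Int.natCast_dvd_of_forall_prime_pow fun r t hr ht => ?_
      rcases Nat.eq_zero_or_pos t with rfl | ht0
      · simp
      have hre : r ∣ e := (dvd_pow_self r ht0.ne').trans ht
      have h4 : r ^ (t - 1) ∣ e / q := by
        rw [← Nat.div_mul_cancel hqe] at ht
        by_cases hrq : r = q
        · rw [← hrq] at ht ⊢
          rw [← Nat.sub_add_cancel ht0, pow_succ] at ht
          exact Nat.dvd_of_mul_dvd_mul_right hr.pos ht
        · exact (pow_dvd_pow _ (by omega)).trans (Nat.Coprime.dvd_of_dvd_mul_right
            (Nat.Coprime.pow_left _ ((Nat.coprime_primes hr hq).mpr hrq)) ht)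
      have := pow_dvd_pow_sub_one (m := 1) le_rfl (by simpa using hprime r hr hre) h4 hr
      rwa [Nat.sub_add_cancel ht0] at this
    let f₁ := QuotientGroup.mk' (Subgroup.center T)
    have hf₁ : Function.Surjective f₁ := QuotientGroup.mk'_surjective _
    have h₁ := h.map f₁
    have hT₁ := closure_map_eq_top hT f₁ hf₁
    have hc₁ : f₁ c ^ (e / q) = 1 := by
      rw [← map_pow]
      exact (QuotientGroup.eq_one_iff _).mpr (mem_center_of_commute hT
        (h.commute_pow_left ha hdvd) (h.commute_pow_right hb hdvd))
    have ha₁ : f₁ a ^ e = 1 := by rw [← map_pow, ha, map_one]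
    have hb₁ : f₁ b ^ e = 1 := by rw [← map_pow, hb, map_one]
    let f₂ := QuotientGroup.mk' (Subgroup.center (T ⧸ Subgroup.center T))
    have hf₂ : Function.Surjective f₂ := QuotientGroup.mk'_surjective _
    have h₂ := h₁.map f₂
    have hT₂ := closure_map_eq_top hT₁ f₂ hf₂
    have ha₂ : f₂ (f₁ a) ^ (e / q) = 1 := by
      rw [← map_pow]
      exact (QuotientGroup.eq_one_iff _).mpr (mem_center_of_commute hT₁
        (Commute.pow_self _ _) (h₁.commute_pow_left_div hα1 ha₁ hq hqe hprime hc₁))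
    have hb₂ : f₂ (f₁ b) ^ (e / q) = 1 := by
      rw [← map_pow]
      exact (QuotientGroup.eq_one_iff _).mpr (mem_center_of_commute hT₁
        (h₁.swap.commute_pow_left_div hα1 hb₁ hq hqe hprime (by rw [inv_pow, hc₁, inv_one]))
        (Commute.pow_self _ _))
    have := ih (e / q) (Nat.div_lt_self he hq.one_lt) h₂ hT₂
      (Nat.div_pos (Nat.le_of_dvd he hqe) hq.pos) (fun r hr hre => hprime r hr (hre.trans hie))
      ha₂ hb₂
    exact Group.of_quotient_center_nilpotent (Group.of_quotient_center_nilpotent this)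

end MacdonaldTriple

/-! ### Sylow projections and the universal property of the Macdonald group. -/

/-- A finite nilpotent group has a projection onto each of its Sylow subgroups. -/
theorem exists_isSylowProjection {G : Type*} [Group G] [Finite G] [Group.IsNilpotent G] {p : ℕ}
    (hp : p.Prime) (J : Sylow p G) :
    ∃ π : G →* (J : Subgroup G), IsSylowProjection J π := by
  have := Fact.mk hp
  classical
  -- A homomorphism to `J` whose kernel has orders prime to `p` is injective on the finite group
  -- `J`, hence an automorphism there; composing with its inverse makes it the identity on `J`.
  suffices ∃ ρ : G →* (J : Subgroup G), ∀ g ∈ ρ.ker, (orderOf g).Coprime p by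
    obtain ⟨ρ, hρ⟩ := this
    let f : (J : Subgroup G) →* (J : Subgroup G) := ρ.comp (J : Subgroup G).subtype
    have hf : Function.Injective f := by
      rw [injective_iff_map_eq_one]
      intro g hg
      have h1 := hρ (g : G) hg
      obtain ⟨k, hk⟩ := J.isPGroup' g
      have h2 : orderOf (g : G) ∣ p ^ k := by
        rw [Subgroup.orderOf_coe]; exact orderOf_dvd_of_pow_eq_one hk
      have h3 := Nat.eq_one_of_dvd_coprimes (h1.pow_right k) dvd_rfl h2
      rw [Subgroup.orderOf_coe] at h3
      exact orderOf_eq_one_iff.mp h3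
    let e := MulEquiv.ofBijective f ⟨hf, Finite.surjective_of_injective hf⟩
    refine ⟨e.symm.toMonoidHom.comp ρ, fun g => ?_, fun g hg => hρ g ?_⟩
    · exact e.symm_apply_apply g
    · rw [MonoidHom.mem_ker] at hg ⊢
      exact (map_eq_one_iff e.symm e.symm.injective).mp hg
  by_cases hpG : p ∣ Nat.card G
  · obtain ⟨e⟩ := Group.isNilpotent_of_finite_tfae (G := G).out 0 4 rfl rfl |>.mp ‹_›
    let p' : (Nat.card G).primeFactors :=
      ⟨p, Nat.mem_primeFactors.mpr ⟨hp, hpG, Nat.card_pos.ne'⟩⟩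
    refine ⟨(Pi.evalMonoidHom _ J).comp ((Pi.evalMonoidHom _ p').comp e.symm.toMonoidHom),
      fun g hg => ?_⟩
    have hg' : e.symm g p' J = 1 := hg
    obtain ⟨v, r, hr, hcard⟩ := Nat.exists_eq_pow_mul_and_not_dvd (Nat.card_pos (α := G)).ne' p
      hp.ne_one
    -- Here `r` is the prime-to-`p` part of the group order; it kills every Sylow factor other than
    -- the one at `p`, where the component of `g` is already trivial.
    have h1 : e.symm g ^ r = 1 := by
      funext q P
      have hq := Nat.prime_of_mem_primeFactors q.2
      have := Fact.mk hq
      by_cases hqp : (q : ℕ) = p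
      · obtain ⟨q, hq'⟩ := q
        subst hqp
        have : P = J := by
          have := Sylow.unique_of_normal J inferInstance
          exact Subsingleton.elim _ _
        subst this
        change (e.symm g p' P) ^ r = 1
        rw [hg', one_pow]
      · obtain ⟨k, hk⟩ := P.isPGroup' (e.symm g q P)
        obtain ⟨k, -, hk⟩ := (Nat.dvd_prime_pow hq).mp (orderOf_dvd_of_pow_eq_one hk)
        change (e.symm g q P) ^ r = 1
        rw [← orderOf_dvd_iff_pow_eq_one, hk]
        have h2 : (q : ℕ) ^ k ∣ p ^ v * r := by
          rw [← hk, ← hcard]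
          exact (orderOf_dvd_natCard _).trans (Subgroup.card_subgroup_dvd_card _)
        exact Nat.Coprime.dvd_of_dvd_mul_left
          (Nat.Coprime.pow _ _ ((Nat.coprime_primes hq hp).mpr hqp)) h2
    have h2 : g ^ r = 1 := by
      rw [← map_pow] at h1
      exact (map_eq_one_iff e.symm e.symm.injective).mp h1
    exact Nat.Coprime.of_dvd_left (orderOf_dvd_of_pow_eq_one h2)
      ((Nat.Prime.coprime_iff_not_dvd hp).mpr hr).symm
  · exact ⟨1, fun g _ => Nat.Coprime.of_dvd_left (orderOf_dvd_natCard g)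
      ((Nat.Prime.coprime_iff_not_dvd hp).mpr hpG).symm⟩

namespace MacdonaldGroup

theorem triple (α : ℤ) :
    MacdonaldTriple α (genA α) (genB α) (groupComm (genA α) (genB α)) := by
  have h1 : groupConj (genA α) (groupComm (genA α) (genB α)) * (genA α ^ α)⁻¹ = 1 :=
    PresentedGroup.one_of_mem (rels := macdonaldRels α) (Or.inl rfl)
  have h2 : groupConj (genB α) (groupComm (genB α) (genA α)) * (genB α ^ α)⁻¹ = 1 :=
    PresentedGroup.one_of_mem (rels := macdonaldRels α) (Or.inr rfl)
  rw [mul_inv_eq_one, groupConj] at h1 h2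
  refine ⟨by rw [groupComm]; group, ?_, ?_⟩
  · rw [← h1]; group
  · rw [← h2]; simp only [groupComm]; group

theorem closure_eq_top (α : ℤ) : Subgroup.closure {genA α, genB α} = ⊤ := by
  rw [← PresentedGroup.closure_range_of (macdonaldRels α)]
  congr 1
  ext g
  simp only [Set.mem_insert_iff, Set.mem_singleton_iff, Set.mem_range, Fin.exists_fin_two, genA,
    genB, eq_comm]

variable {α : ℤ} {T : Type*} [Group T] {a b c : T}

theorem exists_lift (h : MacdonaldTriple α a b c) :
    ∃ f : MacdonaldGroup α →* T, f (genA α) = a ∧ f (genB α) = b := by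
  let F : FreeGroup (Fin 2) →* T := FreeGroup.lift ![a, b]
  have hF0 : F (FreeGroup.of 0) = a := by simp [F]
  have hF1 : F (FreeGroup.of 1) = b := by simp [F]
  have hF : ∀ r ∈ macdonaldRels α, FreeGroup.lift ![a, b] r = 1 := by
    have hc := h.eq_groupComm
    have hc' : groupComm b a = c⁻¹ := by rw [hc]; simp only [groupComm]; group
    rintro r (rfl | rfl)
    · change F _ = 1
      simp only [groupConj, groupComm, map_mul, map_inv, map_zpow, hF0, hF1]
      have h1 := h.conj_left
      rw [mul_inv_eq_one, ← groupComm, ← hc, mul_assoc, h1, inv_mul_cancel_left]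
    · change F _ = 1
      simp only [groupConj, groupComm, map_mul, map_inv, map_zpow, hF0, hF1]
      have h1 := h.conj_right
      rw [mul_inv_eq_one, ← groupComm, hc', inv_inv, h1, mul_inv_cancel_right]
  exact ⟨PresentedGroup.toGroup hF, PresentedGroup.toGroup.of hF, PresentedGroup.toGroup.of hF⟩

theorem finite_and_isNilpotent (h0 : α ≠ 0) (h1 : α ≠ 1) :
    Finite (MacdonaldGroup α) ∧ Group.IsNilpotent (MacdonaldGroup α) := by
  obtain ⟨e, he, hprime, ha, hb⟩ := (triple α).exists_exponent h0 h1
  exact ⟨(triple α).finite (closure_eq_top α) he (isCoprime_of_forall_prime_dvd_sub_one hprime)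
      ha hb,
    MacdonaldTriple.isNilpotent_of_exponent h1 e (triple α) (closure_eq_top α) he hprime ha hb⟩

end MacdonaldGroup

/-! ### Normal forms when the generators have `p`-power order. -/

theorem IsSylowProjection.surjective {p : ℕ} {G : Type*} [Group G] {J : Sylow p G}
    {π : G →* (J : Subgroup G)} (h : IsSylowProjection J π) : Function.Surjective π :=
  fun g => ⟨g, h.1 g⟩

theorem IsSylowProjection.pow_dvd_orderOf {p : ℕ} {G : Type*} [Group G] {J : Sylow p G}
    {π : G →* (J : Subgroup G)} (h : IsSylowProjection J π) {g : G} {s : ℕ}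
    (hg : p ^ s ∣ orderOf g) : p ^ s ∣ orderOf (π g) := by
  have h1 : g ^ orderOf (π g) ∈ π.ker := by
    rw [MonoidHom.mem_ker, map_pow, pow_orderOf_eq_one]
  have h2 : orderOf g ∣ orderOf (π g) * orderOf (g ^ orderOf (π g)) := by
    rw [orderOf_dvd_iff_pow_eq_one, pow_mul, pow_orderOf_eq_one]
  exact Nat.Coprime.dvd_of_dvd_mul_right (Nat.Coprime.pow_left _ (h.2 _ h1).symm) (hg.trans h2)

/-- In the cyclic `p`-group generated by `g`, the subgroup generated by `g ^ Y` depends only on the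
valuation of `Y`, which is at most `h`. -/
theorem exists_pow_eq_zpow_zpow {T : Type*} [Group T] {g : T} {p s h : ℕ} (hp : p.Prime)
    (hg : g ^ p ^ s = 1) {Y : ℤ} (hY : ¬ (p : ℤ) ^ (h + 1) ∣ Y) :
    ∃ z : ℤ, g ^ p ^ h = (g ^ Y) ^ z := by
  have hp' : Prime (p : ℤ) := Nat.prime_iff_prime_int.mp hp
  have hY0 : Y ≠ 0 := by rintro rfl; exact hY (dvd_zero _)
  obtain ⟨v, hv, u, hu, hu'⟩ : ∃ v ≤ h, ∃ u : ℤ, Y = p ^ v * u ∧ ¬ (p : ℤ) ∣ u := by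
    obtain ⟨-, ⟨u, hu⟩, h2⟩ | h1 := or_iff_not_imp_right.mpr
      (fun hd : ¬ ¬ (p : ℤ) ∣ Y => padicValInt_exact hp hY0 (not_not.mp hd))
    · refine ⟨padicValInt p Y, ?_, u, hu, ?_⟩
      · by_contra hlt
        exact hY ((pow_dvd_pow _ (by omega)).trans ⟨u, hu⟩)
      · rintro ⟨w, rfl⟩
        exact h2 ⟨w, by rw [pow_succ, mul_assoc]; exact hu⟩
    · exact ⟨0, Nat.zero_le _, Y, by simp, h1⟩
  have hcop : IsCoprime ((p ^ s : ℕ) : ℤ) u := by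
    push_cast
    exact IsCoprime.pow_left ((Prime.coprime_iff_not_dvd hp').mpr hu')
  obtain ⟨x, y, hxy⟩ := hcop
  refine ⟨y * p ^ (h - v), ?_⟩
  rw [← zpow_mul, ← zpow_natCast]
  refine (zpow_eq_zpow_of_dvd_sub hg ⟨-(x * p ^ h), ?_⟩).symm
  have h2 : (p : ℤ) ^ h = p ^ v * p ^ (h - v) := by rw [← pow_add]; congr 1; omega
  push_cast at hxy ⊢
  rw [hu]
  linear_combination (p : ℤ) ^ v * p ^ (h - v) * hxy + (x * p ^ s - 1) * h2

theorem card_of_hasUniqueNormalForm {T : Type*} [Group T] {a b c : T} {i₀ j₀ k₀ : ℕ}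
    (h : HasUniqueNormalForm a b c i₀ j₀ k₀) : Nat.card T = i₀ * j₀ * k₀ := by
  let f : Fin i₀ × Fin j₀ × Fin k₀ → T := fun t =>
    a ^ (t.1 : ℕ) * b ^ (t.2.1 : ℕ) * c ^ (t.2.2 : ℕ)
  have hf : Function.Bijective f := by
    constructor
    · rintro ⟨i, j, k⟩ ⟨i', j', k'⟩ heq
      have := (h (f (i, j, k))).unique (y₁ := (i, j, k)) (y₂ := (i', j', k'))
        ⟨i.2, j.2, k.2, rfl⟩ ⟨i'.2, j'.2, k'.2, heq⟩
      simp only [Prod.mk.injEq, Fin.val_inj] at this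
      simp [this]
    · intro g
      obtain ⟨⟨i, j, k⟩, ⟨hi, hj, hk, hg⟩, -⟩ := h g
      exact ⟨(⟨i, hi⟩, ⟨j, hj⟩, ⟨k, hk⟩), hg.symm⟩
  rw [← Nat.card_eq_of_bijective f hf]
  simp [mul_assoc]

namespace MacdonaldTriple

variable {T : Type*} [Group T] {α : ℤ} {a b c : T} {p m h : ℕ}

theorem not_dvd_exponent (hp : p.Prime) (hm : 1 ≤ m) (hn : (p : ℤ) ^ m ∣ α - 1) :
    ¬ (p : ℤ) ∣ α := fun hd => by
  have h1 : (p : ℤ) ∣ α - 1 := (dvd_pow_self _ (by omega)).trans hn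
  have h2 : (p : ℤ) ∣ 1 := by simpa using dvd_sub hd h1
  exact hp.one_lt.ne' (by exact_mod_cast Int.eq_one_of_dvd_one (by positivity) h2)

/-- Turns a bound on the valuation of the exponent in `zpow_left_fundamental_eq_one` into the two
facts that control the size of the group. -/
theorem pow_left_of_fundamental (H : MacdonaldTriple α a b c) (hp : p.Prime) (hm : 1 ≤ m)
    (hn : (p : ℤ) ^ m ∣ α - 1) {s : ℕ} (ha : a ^ p ^ s = 1) {k M : ℕ} (hM : (M : ℤ) = α ^ k)
    (hX : ¬ (p : ℤ) ^ (h + m + 1) ∣ (α - 1) * (powSum α M - α ^ (k + M))) :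
    a ^ p ^ (h + m) = 1 ∧ ∃ x : ℤ, a ^ p ^ h = b ^ x := by
  constructor
  · obtain ⟨z, hz⟩ := exists_pow_eq_zpow_zpow hp ha hX
    rw [hz, H.zpow_left_fundamental_eq_one hM, one_zpow]
  · have hY : ¬ (p : ℤ) ^ (h + 1) ∣ (powSum α M - α ^ (k + M)) * α ^ (k + M) := by
      intro hd
      have hcop : IsCoprime ((p : ℤ) ^ (h + 1)) (α ^ (k + M)) :=
        IsCoprime.pow ((Prime.coprime_iff_not_dvd (Nat.prime_iff_prime_int.mp hp)).mpr
          (not_dvd_exponent hp hm hn))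
      refine hX ?_
      rw [show h + m + 1 = m + (h + 1) by ring, pow_add]
      exact mul_dvd_mul hn (hcop.dvd_of_dvd_mul_right hd)
    obtain ⟨z, hz⟩ := exists_pow_eq_zpow_zpow hp ha hY
    exact ⟨_, by rw [hz, H.zpow_left_eq_zpow_right hM, ← zpow_mul]⟩

theorem pow_comm_eq (H : MacdonaldTriple α a b c) {N : ℕ} (hN : Commute (a ^ N) b) :
    c ^ N = a ^ (N - powSum α N) := by
  have h1 := H.pow_left_mul_right N
  rw [hN.eq, mul_assoc] at h1
  have h2 := mul_left_cancel h1
  rw [zpow_sub, zpow_natCast, h2, mul_inv_cancel_right]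

/-- If `p ^ h`-th powers of the generators are central, then there are at most
`p ^ (h + m) * p ^ h * p ^ h` elements. -/
theorem exists_normalForm (H : MacdonaldTriple α a b c) (hT : Subgroup.closure {a, b} = ⊤)
    (hp : p.Prime) (hm : 1 ≤ m) (hn : (p : ℤ) ^ m ∣ α - 1) (hn' : ¬ (p : ℤ) ^ (m + 1) ∣ α - 1)
    (ha : a ^ p ^ (h + m) = 1) (hb : b ^ p ^ (h + m) = 1) (hab : ∃ x : ℤ, a ^ p ^ h = b ^ x)
    (hba : ∃ x : ℤ, b ^ p ^ h = a ^ x) (g : T) :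
    ∃ i < p ^ (h + m), ∃ j < p ^ h, ∃ k < p ^ h, g = a ^ i * b ^ j * c ^ k := by
  have hcop : IsCoprime ((p ^ (h + m) : ℕ) : ℤ) α := by
    push_cast
    exact IsCoprime.pow_left ((Prime.coprime_iff_not_dvd (Nat.prime_iff_prime_int.mp hp)).mpr
      (not_dvd_exponent hp hm hn))
  obtain ⟨i, -, j, -, k, -, hg⟩ := H.exists_eq_pow_mul_pow_mul_pow hT (pow_pos hp.pos _) hcop ha hb g
  obtain ⟨x, hx⟩ := hab
  obtain ⟨y, hy⟩ := hba
  have hab' : Commute (a ^ p ^ h) b := by rw [hx]; exact Commute.zpow_self b x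
  have hcP := H.pow_comm_eq hab'
  -- Hence `c ^ p ^ h` is a power of the central element `a ^ p ^ h`, and excess powers of `b` and
  -- `c` can be absorbed into `a`.
  obtain ⟨w, hw⟩ : ((p ^ h : ℕ) : ℤ) ∣ ((p ^ h : ℕ) : ℤ) - powSum α (p ^ h) := by
    rw [← dvd_neg, neg_sub]
    have := pow_dvd_powSum_sub hp hm hn hn' (dvd_refl (p ^ h))
    have h1 := twoDefect_le_one p
    push_cast at this ⊢
    exact (pow_dvd_pow _ (by omega)).trans this
  rw [hw, zpow_mul, zpow_natCast] at hcP
  have h1 : b ^ j = (a ^ y) ^ (j / p ^ h) * b ^ (j % p ^ h) := by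
    rw [← hy, ← pow_mul, ← pow_add, Nat.div_add_mod]
  have h2 : c ^ k = ((a ^ p ^ h) ^ w) ^ (k / p ^ h) * c ^ (k % p ^ h) := by
    rw [← hcP, ← pow_mul, ← pow_add, Nat.div_add_mod]
  obtain ⟨i', hi', hi⟩ := exists_zpow_eq_pow (pow_pos hp.pos (h + m)) ha
    (i + y * (j / p ^ h : ℕ) + p ^ h * w * (k / p ^ h : ℕ))
  refine ⟨i', hi', _, Nat.mod_lt j (pow_pos hp.pos h), _, Nat.mod_lt k (pow_pos hp.pos h), ?_⟩
  have h3 : Commute (b ^ (j % p ^ h)) (((a ^ p ^ h) ^ w) ^ (k / p ^ h)) :=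
    (((hab'.symm.pow_left _).zpow_right _).pow_right _)
  rw [hg, ← hi, h1, h2, ← mul_assoc, ← mul_assoc, mul_assoc (a ^ i * _), h3.eq, zpow_add, zpow_add,
    zpow_mul, zpow_mul a (_ * w), zpow_mul a _ w, zpow_natCast, zpow_natCast, zpow_natCast,
    ← Nat.cast_pow, zpow_natCast]
  simp only [mul_assoc]

theorem dvd_of_commute (H : MacdonaldTriple α a b c) (hp : p.Prime)
    (hn' : ¬ (p : ℤ) ^ (m + 1) ∣ α - 1) (ha : orderOf a = p ^ (h + m)) {x : ℤ}
    (hx : Commute (a ^ x) b) : (p : ℤ) ^ h ∣ x := by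
  have h1 := H.zpow_left_eq_one_of_commute_right hx
  rw [← orderOf_dvd_iff_zpow_eq_one, ha] at h1
  push_cast at h1
  exact Int.pow_dvd_of_pow_dvd_mul hp h1 hn'

/-- This is a relation of the same shape for the swapped triple, so statements about `i` transfer to
`j`. -/
theorem inv_relation {i j : ℤ} {k : ℕ} (hr : a ^ i * b ^ j * c ^ k = 1) :
    b ^ (-j) * a ^ (-i) * c⁻¹ ^ k = 1 := by
  have h1 : (c ^ k)⁻¹ * b ^ (-j) * a ^ (-i) = 1 := by
    rw [← inv_inj, inv_one, ← hr]; group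
  rw [inv_pow, mul_eq_one_iff_eq_inv, inv_inv]
  rwa [mul_assoc, inv_mul_eq_one, eq_comm] at h1

theorem commute_zpow_left_of_dvd (hab : Commute (a ^ p ^ h) b) {x : ℤ} (hx : (p : ℤ) ^ h ∣ x) :
    Commute (a ^ x) b := by
  obtain ⟨w, rfl⟩ := hx
  rw [zpow_mul, ← Nat.cast_pow, zpow_natCast]
  exact hab.zpow_left w

theorem zpow_sub_one_mul_eq (H : MacdonaldTriple α a b c) {e : ℕ} (hb : b ^ e = 1) {β : ℤ}
    (hβ : (e : ℤ) ∣ α * β - 1) {i j : ℤ} (hc : Commute (a ^ i * b ^ j) c) :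
    a ^ ((α - 1) * i) = b ^ (j - β * j) := by
  have h1 := H.zpow_left_mul i
  have h2 := H.pow_mul_zpow_right (β * j) 1
  rw [pow_one, pow_one] at h2
  have h3 : b ^ (α * (β * j)) = b ^ j := by
    refine zpow_eq_zpow_of_dvd_sub hb ?_
    rw [← mul_assoc, ← sub_one_mul]
    exact hβ.mul_right j
  rw [h3] at h2
  have h4 : a ^ i * b ^ j * c = c * (a ^ (α * i) * b ^ (β * j)) := by
    rw [mul_assoc, ← h2, ← mul_assoc, h1, mul_assoc]
  rw [hc.eq] at h4
  have h5 := mul_left_cancel h4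
  have : a ^ (α * i) = a ^ i * b ^ j * (b ^ (β * j))⁻¹ := by rw [h5, mul_inv_cancel_right]
  rw [show (α - 1) * i = -i + α * i by ring, zpow_add, this, zpow_sub]; group

/-- Since `a ^ i * b ^ j` is a power of `c`, conjugating it by `c` shows that `a ^ ((α - 1) * i)` is
a power of `b`, hence central. -/
theorem dvd_of_relation_one (H : MacdonaldTriple α a b c) (hp : p.Prime)
    (hn' : ¬ (p : ℤ) ^ (m + 1) ∣ α - 1) (ha : orderOf a = p ^ (h + m))
    (hb : orderOf b = p ^ (h + m)) {β : ℤ} (hβ : ((p ^ (h + m) : ℕ) : ℤ) ∣ α * β - 1) (hmh : m ≤ h)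
    {i j : ℤ} {k : ℕ} (hr : a ^ i * b ^ j * c ^ k = 1) : (p : ℤ) ^ (h - m) ∣ i := by
  have h1 := H.zpow_sub_one_mul_eq (i := i) (j := j) (hb ▸ pow_orderOf_eq_one b) hβ (by
    rw [mul_eq_one_iff_eq_inv.mp hr]; exact ((Commute.refl c).pow_left k).inv_left)
  have h2 := H.dvd_of_commute hp hn' ha (x := (α - 1) * i) (by
    rw [h1]; exact Commute.zpow_self b _)
  refine Int.pow_dvd_of_pow_dvd_mul hp (B := m) ?_ hn'
  rwa [Nat.sub_add_cancel hmh]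

/-- Conjugating the relation by `b` produces a second one, `c ^ i * a ^ r * b ^ t = 1` with `r =
powSum α i - i`. The weak divisibility of `i` already makes `r`, and then `t`, divisible by `p ^ h`;
so `c ^ i` commutes with `a`, which forces `p ^ (h + m) ∣ α ^ i - 1`. -/
theorem dvd_of_relation_two (H : MacdonaldTriple α a b c) (hp : p.Prime)
    (hm : twoDefect p < m) (hn : (p : ℤ) ^ m ∣ α - 1)
    (hn' : ¬ (p : ℤ) ^ (m + 1) ∣ α - 1) (ha : orderOf a = p ^ (h + m))
    (hb : orderOf b = p ^ (h + m)) {β : ℤ} (hβ : ((p ^ (h + m) : ℕ) : ℤ) ∣ α * β - 1) (hmh : m ≤ h)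
    (hba : Commute (b ^ p ^ h) a)
    {i j : ℤ} {k : ℕ} (hr : a ^ i * b ^ j * c ^ k = 1)
    (hi : (p : ℤ) ^ (h - m + twoDefect p) ∣ i) : (p : ℤ) ^ h ∣ i := by
  have ha1 : a ^ p ^ (h + m) = 1 := ha ▸ pow_orderOf_eq_one a
  have hb1 : b ^ p ^ (h + m) = 1 := hb ▸ pow_orderOf_eq_one b
  -- A nonnegative representative of `i`, since `i` becomes an exponent of `c` and an argument of
  -- `powSum`.
  obtain ⟨i', -, hi'⟩ := exists_zpow_eq_pow (pow_pos hp.pos (h + m)) ha1 i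
  have hdvd : (p : ℤ) ^ (h + m) ∣ i - i' := by
    have : a ^ (i - i') = 1 := by rw [zpow_sub, hi', zpow_natCast, mul_inv_cancel]
    rw [← orderOf_dvd_iff_zpow_eq_one, ha] at this
    exact_mod_cast this
  have hdvd' : ∀ r ≤ h + m, (p : ℤ) ^ r ∣ i ↔ (p : ℤ) ^ r ∣ (i' : ℤ) := fun r hr => by
    have := (pow_dvd_pow (p : ℤ) hr).trans hdvd
    exact (dvd_iff_dvd_of_dvd_sub this)
  have hle := twoDefect_le_one p
  rw [hdvd' _ (by omega)] at hi ⊢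
  rw [hi'] at hr
  have hi2 : p ^ (h - m + twoDefect p) ∣ i' := by exact_mod_cast hi
  have h1 := H.pow_left_mul_right i'
  have h2 : c ^ i' * a ^ (powSum α i' - i') * b ^ (β ^ k * (α ^ k - 1)) = 1 := by
    have h3 := H.pow_mul_zpow_right 1 k
    rw [zpow_one, mul_one] at h3
    have h4 : b ^ j = (a ^ i')⁻¹ * (c ^ k)⁻¹ := by
      rw [eq_mul_inv_iff_mul_eq]
      exact eq_inv_of_mul_eq_one_right (by rw [← mul_assoc, hr])
    have h5 : b ^ (β ^ k * (α ^ k - 1)) = (c ^ k)⁻¹ * b ^ (α ^ k - 1) * c ^ k := by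
      rw [mul_assoc, eq_inv_mul_iff_mul_eq, H.pow_mul_zpow_right]
      congr 1
      refine zpow_eq_zpow_of_dvd_sub hb1 ?_
      have h6 := sub_dvd_pow_sub_pow (α * β) 1 k
      rw [one_pow] at h6
      have h7 := (hβ.trans h6).mul_right (α ^ k - 1)
      rwa [show (α * β) ^ k - 1 = α ^ k * β ^ k - 1 by rw [mul_pow], sub_one_mul, mul_assoc] at h7
    calc c ^ i' * a ^ (powSum α i' - i') * b ^ (β ^ k * (α ^ k - 1))
        = b⁻¹ * (b * c ^ i' * a ^ powSum α i') * ((a ^ i')⁻¹ * (c ^ k)⁻¹) *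
            b ^ (α ^ k - 1) * c ^ k := by
          rw [h5, zpow_sub, zpow_natCast]; group
      _ = b⁻¹ * a ^ i' * b * b ^ j * (b⁻¹ * b ^ α ^ k) * c ^ k := by
          rw [← h1, ← h4, zpow_sub, zpow_one]; group
      _ = b⁻¹ * (a ^ i' * b ^ j * (b ^ α ^ k * c ^ k)) := by group
      _ = b⁻¹ * (a ^ i' * b ^ j * c ^ k) * b := by rw [← h3]; group
      _ = 1 := by rw [hr]; group
  set r := powSum α i' - i' with hr_def
  set t := β ^ k * (α ^ k - 1)
  have h3 : a ^ r * b ^ t = (c ^ i')⁻¹ := by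
    rw [mul_assoc] at h2; exact eq_inv_of_mul_eq_one_right h2
  have h4 := H.zpow_sub_one_mul_eq (i := r) (j := t) hb1 hβ (by
    rw [h3]; exact ((Commute.refl c).pow_left _).inv_left)
  have hrh : (p : ℤ) ^ h ∣ r := by
    have := pow_dvd_powSum_sub hp (by omega) hn hn' hi2
    rwa [show h - m + twoDefect p + m - twoDefect p = h by omega] at this
  have h5 : a ^ ((α - 1) * r) = 1 := by
    rw [← orderOf_dvd_iff_zpow_eq_one, ha]
    push_cast
    rw [add_comm, pow_add]
    exact mul_dvd_mul hn hrh
  have hth : (p : ℤ) ^ h ∣ t := by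
    refine Int.pow_dvd_of_pow_dvd_mul hp (B := m) (x := α - 1) ?_ hn'
    have h6 : b ^ ((α - 1) * t) = 1 := by
      have h7 : b ^ (α * (t - β * t)) = 1 := by
        rw [mul_comm, zpow_mul, ← h4, h5, one_zpow]
      rw [← h7]
      refine zpow_eq_zpow_of_dvd_sub hb1 ?_
      rw [show (α - 1) * t - α * (t - β * t) = (α * β - 1) * t by ring]
      exact hβ.mul_right t
    rw [← orderOf_dvd_iff_zpow_eq_one, hb] at h6
    exact_mod_cast h6
  have h6 : Commute (c ^ i') a := by
    rw [← inv_inv (c ^ i'), ← h3]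
    exact ((Commute.zpow_self a r).mul_left (commute_zpow_left_of_dvd hba hth)).inv_left
  have h7 := H.zpow_left_mul_pow 1 i'
  rw [zpow_one, h6.symm.eq, mul_one] at h7
  have h8 : a ^ (α ^ i' - 1) = 1 := by
    rw [zpow_sub, ← mul_left_cancel h7, zpow_one, mul_inv_cancel]
  rw [← orderOf_dvd_iff_zpow_eq_one, ha] at h8
  push_cast at h8
  exact_mod_cast pow_dvd_of_pow_dvd_pow_sub_one hp hm hn hn' h8

/-- A relation `a ^ i * b ^ j * c ^ k = 1` is trivial modulo `p ^ h`. -/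
theorem dvd_of_relation (H : MacdonaldTriple α a b c) (hp : p.Prime)
    (hm : 1 ≤ m) (hn : (p : ℤ) ^ m ∣ α - 1)
    (hn' : ¬ (p : ℤ) ^ (m + 1) ∣ α - 1) (ha : orderOf a = p ^ (h + m))
    (hb : orderOf b = p ^ (h + m)) (hmh : m ≤ h)
    (hab : Commute (a ^ p ^ h) b) (hba : Commute (b ^ p ^ h) a)
    (htwo : p = 2 → h + 1 = 2 * m ∧ ∀ (i j : ℤ) (k : ℕ), a ^ i * b ^ j * c ^ k = 1 →
      (2 : ℤ) ^ m ∣ i ∧ (2 : ℤ) ^ m ∣ j)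
    {i j : ℤ} {k : ℕ} (hr : a ^ i * b ^ j * c ^ k = 1) : p ^ h ∣ k ∧ (p : ℤ) ^ h ∣ j := by
  have hcop : IsCoprime ((p ^ (h + m) : ℕ) : ℤ) α := by
    push_cast
    exact IsCoprime.pow_left ((Prime.coprime_iff_not_dvd (Nat.prime_iff_prime_int.mp hp)).mpr
      (not_dvd_exponent hp hm hn))
  obtain ⟨β, hβ⟩ := exists_inverse_mod hcop
  have hr' := inv_relation hr
  have hbase : (p : ℤ) ^ (h - m + twoDefect p) ∣ i ∧ (p : ℤ) ^ (h - m + twoDefect p) ∣ j := by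
    by_cases h2 : p = 2
    · obtain ⟨h3, h4⟩ := htwo h2
      subst h2
      rw [twoDefect_two, show h - m + 1 = m by omega]
      exact_mod_cast h4 i j k hr
    · rw [twoDefect_of_ne h2, add_zero]
      refine ⟨H.dvd_of_relation_one hp hn' ha hb hβ hmh hr, ?_⟩
      rw [← dvd_neg]
      exact H.swap.dvd_of_relation_one hp hn' hb ha hβ hmh hr'
  have hij : (p : ℤ) ^ h ∣ i ∧ (p : ℤ) ^ h ∣ j := by
    by_cases hm' : twoDefect p < m
    · refine ⟨H.dvd_of_relation_two hp hm' hn hn' ha hb hβ hmh hba hr hbase.1, ?_⟩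
      rw [← dvd_neg]
      exact H.swap.dvd_of_relation_two hp hm' hn hn' hb ha hβ hmh hab hr'
        ((dvd_neg (α := ℤ)).mpr hbase.2)
    · have h2 : p = 2 := by
        by_contra h2
        rw [twoDefect_of_ne h2] at hm'
        omega
      obtain ⟨h3, -⟩ := htwo h2
      subst h2
      rw [twoDefect_two] at hbase hm'
      rwa [show h - m + 1 = h by omega] at hbase
  refine ⟨?_, hij.2⟩
  have h6 : Commute (c ^ k) a := by
    rw [← inv_inv (c ^ k), ← eq_inv_of_mul_eq_one_left hr]
    exact ((Commute.zpow_self a i).mul_left (commute_zpow_left_of_dvd hba hij.2)).inv_left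
  have h7 := H.zpow_left_mul_pow 1 k
  rw [zpow_one, h6.symm.eq, mul_one] at h7
  have h8 : a ^ (α ^ k - 1) = 1 := by
    rw [zpow_sub, ← mul_left_cancel h7, zpow_one, mul_inv_cancel]
  rw [← orderOf_dvd_iff_zpow_eq_one, ha] at h8
  push_cast at h8
  by_cases hm' : twoDefect p < m
  · exact pow_dvd_of_pow_dvd_pow_sub_one hp hm' hn hn' h8
  · have h2 : p = 2 := by
      by_contra h2
      rw [twoDefect_of_ne h2] at hm'
      omega
    obtain ⟨h3, -⟩ := htwo h2
    subst h2
    rw [twoDefect_two] at hm'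
    obtain rfl : m = 1 := by omega
    obtain rfl : h = 1 := by omega
    rw [pow_one]
    -- For `p = 2` and `m = h = 1` lifting of exponents fails, but `α ≡ 3` mod `4`, so `4 ∣ α ^ k -
    -- 1` forces `k` to be even.
    by_contra hk
    obtain ⟨w, rfl⟩ : Odd k := Nat.not_even_iff_odd.mp fun he => hk he.two_dvd
    obtain ⟨x, hx⟩ := hn
    have hx2 : ¬ (2 : ℤ) ∣ x := by
      rintro ⟨y, rfl⟩; exact hn' ⟨y, by push_cast at hx ⊢; linarith⟩
    obtain ⟨y, rfl⟩ : Odd x := Int.not_even_iff_odd.mp fun he => hx2 he.two_dvd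
    obtain ⟨z, hz⟩ := h8
    push_cast at hx hz
    have hα : α ^ 2 = 1 + 4 * (4 * y ^ 2 + 6 * y + 2) := by
      rw [show α = 4 * y + 3 by linarith]; ring
    obtain ⟨v, hv⟩ : ∃ v, α ^ (2 * w) = 1 + 4 * v := by
      have := sub_dvd_pow_sub_pow (α ^ 2) 1 w
      rw [one_pow, ← pow_mul] at this
      obtain ⟨v, hv⟩ := this
      exact ⟨(4 * y ^ 2 + 6 * y + 2) * v, by rw [hα] at hv; linarith⟩
    rw [pow_succ, hv, show α = 4 * y + 3 by linarith] at hz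
    ring_nf at hz
    omega

theorem hasUniqueNormalForm (H : MacdonaldTriple α a b c) (hT : Subgroup.closure {a, b} = ⊤)
    (hp : p.Prime) (hm : 1 ≤ m) (hn : (p : ℤ) ^ m ∣ α - 1)
    (hn' : ¬ (p : ℤ) ^ (m + 1) ∣ α - 1) (ha : orderOf a = p ^ (h + m))
    (hb : orderOf b = p ^ (h + m)) (hmh : m ≤ h)
    (hab : ∃ x : ℤ, a ^ p ^ h = b ^ x) (hba : ∃ x : ℤ, b ^ p ^ h = a ^ x)
    (htwo : p = 2 → h + 1 = 2 * m ∧ ∀ (i j : ℤ) (k : ℕ), a ^ i * b ^ j * c ^ k = 1 →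
      (2 : ℤ) ^ m ∣ i ∧ (2 : ℤ) ^ m ∣ j) :
    HasUniqueNormalForm a b c (p ^ (h + m)) (p ^ h) (p ^ h) := by
  have hab' : Commute (a ^ p ^ h) b := by
    obtain ⟨x, hx⟩ := hab; rw [hx]; exact Commute.zpow_self b x
  have hba' : Commute (b ^ p ^ h) a := by
    obtain ⟨x, hx⟩ := hba; rw [hx]; exact Commute.zpow_self a x
  have key : ∀ i j k i' j' k' : ℕ, i < p ^ (h + m) → j < p ^ h → k < p ^ h → i' < p ^ (h + m) →
      j' < p ^ h → k' ≤ k → a ^ i * b ^ j * c ^ k = a ^ i' * b ^ j' * c ^ k' →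
      i = i' ∧ j = j' ∧ k = k' := by
    intro i j k i' j' k' hi hj hk hi' hj' hkk heq
    obtain ⟨d, rfl⟩ := Nat.exists_eq_add_of_le' hkk
    -- Two normal forms are merged into one relation after cancelling `c ^ k'`; the factor `α ^ d`
    -- comes from moving `b ^ (-j')` past `c ^ d`.
    have h1 : a ^ ((i : ℤ) - i') * b ^ ((j : ℤ) - α ^ d * j') * c ^ d = 1 := by
      have h2 := H.pow_mul_zpow_right (-j' : ℤ) d
      rw [pow_add, ← mul_assoc] at heq
      have h3 := mul_right_cancel heq
      calc a ^ ((i : ℤ) - i') * b ^ ((j : ℤ) - α ^ d * j') * c ^ d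
          = (a ^ i')⁻¹ * (a ^ i * b ^ j) * (b ^ (α ^ d * (-j' : ℤ)) * c ^ d) := by
            rw [sub_eq_add_neg (j : ℤ), zpow_add b, mul_neg, ← neg_add_eq_sub, zpow_add a]
            simp only [zpow_neg, zpow_natCast, mul_assoc]
        _ = (a ^ i')⁻¹ * (a ^ i * b ^ j * c ^ d) * b ^ (-j' : ℤ) := by
            rw [← h2]; simp only [mul_assoc]
        _ = 1 := by rw [h3]; group
    obtain ⟨hd, hjd⟩ := H.dvd_of_relation hp hm hn hn' ha hb hmh hab' hba' htwo h1
    obtain rfl : d = 0 := Nat.eq_zero_of_dvd_of_lt hd (by omega)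
    have hjj : j = j' := by
      rw [pow_zero, one_mul] at hjd
      have h4 : (j' : ℤ) ≡ j [ZMOD ((p ^ h : ℕ) : ℤ)] :=
        Int.modEq_iff_dvd.mpr (by push_cast; exact hjd)
      exact (Nat.ModEq.eq_of_lt_of_lt (Int.natCast_modEq_iff.mp h4) hj' hj).symm
    subst hjj
    refine ⟨?_, rfl, by simp⟩
    rw [zero_add] at heq
    have h5 := mul_right_cancel (mul_right_cancel heq)
    exact pow_injOn_Iio_orderOf (by simpa [ha] using hi) (by simpa [ha] using hi') h5
  intro g
  obtain ⟨i, hi, j, hj, k, hk, rfl⟩ := H.exists_normalForm hT hp hm hn hn'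
    (ha ▸ pow_orderOf_eq_one a) (hb ▸ pow_orderOf_eq_one b) hab hba g
  refine ⟨(i, j, k), ⟨hi, hj, hk, rfl⟩, ?_⟩
  rintro ⟨i', j', k'⟩ ⟨hi', hj', hk', heq⟩
  rcases Nat.le_total k' k with hle | hle
  · obtain ⟨rfl, rfl, rfl⟩ := key i j k i' j' k' hi hj hk hi' hj' hle heq
    rfl
  · obtain ⟨rfl, rfl, rfl⟩ := key i' j' k' i j k hi' hj' hk' hi hj hle heq.symm
    rfl

end MacdonaldTriple

/-! ### Valuation of the exponent in the fundamental relation. -/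

theorem pow_dvd_self_pow_sub {p m n : ℕ} (hp : p.Prime) (hm : 1 ≤ m) (hn : p ^ m ∣ n) :
    (p : ℤ) ^ (3 * m + 1 - twoDefect p) ∣
      (1 + n : ℤ) ^ n - (1 + n * n + n.choose 2 * n ^ 2 + n.choose 3 * n ^ 3) := by
  have hn' : (p : ℤ) ^ m ∣ (n : ℤ) := by exact_mod_cast hn
  rcases Nat.lt_or_ge n 3 with h | h
  · interval_cases n <;> simp [Nat.choose]
  obtain ⟨N, rfl⟩ := Nat.exists_eq_add_of_le' h
  have : ∀ s x₀ x₁ x₂ x₃ y : ℤ, x₃ + x₂ + x₁ + x₀ = y → s + x₃ + x₂ + x₁ + x₀ - y = s := by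
    intro s x₀ x₁ x₂ x₃ y h; rw [← h]; ring
  rw [add_comm (1 : ℤ), add_pow, show N + 3 + 1 = N + 4 by rfl, Finset.sum_range_succ',
    Finset.sum_range_succ', Finset.sum_range_succ', Finset.sum_range_succ', this]
  · refine Finset.dvd_sum fun k _ => ?_
    have h2 := pow_dvd_choose_mul_pow hp (k := k + 4) (by omega) hn' hn
    have h3 := padicValNat_add_three_le hp (k := k + 4) (by omega)
    have h4 : 3 * m + 1 - twoDefect p ≤ m + (k + 4) * m - padicValNat p (k + 4) := by
      have : (k + 4) * m = 4 * m + k * m := by ring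
      have : k ≤ k * m := Nat.le_mul_of_pos_right k hm
      omega
    rw [one_pow, mul_one, mul_comm (_ ^ _)]
    exact (pow_dvd_pow _ h4).trans h2
  · simp
    ring

/-- The `p`-adic valuation of the exponent in the relation between the powers of the
generators. -/
theorem not_pow_dvd_fundamental {p m d : ℕ} (hp : p.Prime) (hm : 1 ≤ m) (hn : p ^ m ∣ 6 * d)
    (hn' : ¬ p ^ (m + 1) ∣ 6 * d) (hd : ¬ p ∣ 1 + 2 * d) :
    ¬ (p : ℤ) ^ (3 * m + 1 - twoDefect p) ∣ (6 * d - 1 : ℤ) * (1 + 6 * d) ^ (6 * d + 1) + 1 := by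
  have hp' : Prime (p : ℤ) := Nat.prime_iff_prime_int.mp hp
  have hle := twoDefect_le_one p
  obtain ⟨E, hE⟩ := pow_dvd_self_pow_sub hp hm hn
  obtain ⟨u, hu⟩ := hn
  have hu' : ¬ p ∣ u := by rintro ⟨w, rfl⟩; exact hn' ⟨w, by rw [hu]; ring⟩
  have hu2 : (6 * d : ℤ) = p ^ m * u := by exact_mod_cast hu
  have hc2 : ((6 * d).choose 2 : ℤ) = 3 * d * (6 * d - 1) := by
    rcases d with _ | d
    · simp
    have h1 := Nat.add_one_mul_choose_eq (6 * d + 5) 1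
    rw [Nat.choose_one_right] at h1
    zify at h1
    rw [show 6 * (d + 1) = 6 * d + 5 + 1 by ring]
    push_cast
    linarith
  have hc3 : ((6 * d).choose 3 : ℤ) = d * (6 * d - 1) * (6 * d - 2) := by
    rcases d with _ | d
    · simp
    have h1 := Nat.add_one_mul_choose_eq (6 * d + 5) 2
    have h2 := Nat.add_one_mul_choose_eq (6 * d + 4) 1
    rw [Nat.choose_one_right] at h2
    zify at h1 h2
    rw [show 6 * (d + 1) = 6 * d + 5 + 1 by ring]
    push_cast
    norm_num at h1 h2
    nlinarith
  intro hdvd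
  push_cast at hE
  rw [hc2, hc3] at hE
  obtain ⟨W, hW⟩ := hdvd
  have hqn : (p : ℤ) ^ (3 * m + 1 - twoDefect p) ∣ (6 * d) ^ 5 := by
    rw [hu2, mul_pow, ← pow_mul]
    exact Dvd.dvd.mul_right (pow_dvd_pow _ (by omega)) _
  obtain ⟨F, hF⟩ := hqn
  -- With `n = 6 * d`, the expression is `n ^ 3 * (1 + n / 3) / 2` to this precision: the terms of
  -- degree below three cancel. Writing `n` as `6 * d` keeps the coefficients integral.
  have key : (p : ℤ) ^ (3 * m + 1 - twoDefect p) ∣ 108 * d ^ 3 * (1 + 2 * d) := by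
    refine ⟨W - F * (4 * d - 18 * d ^ 2 + 36 * d ^ 3) - (36 * d ^ 2 - 1) * E, ?_⟩
    rw [pow_succ] at hW
    linear_combination hW - (36 * (d : ℤ) ^ 2 - 1) * hE - (4 * d - 18 * d ^ 2 + 36 * d ^ 3) * hF
  have key2 : (p : ℤ) ^ (3 * m + 1) ∣ 2 * (108 * d ^ 3 * (1 + 2 * d)) := by
    by_cases h2 : p = 2
    · subst h2
      rw [twoDefect_two, Nat.add_sub_cancel] at key
      rw [pow_succ, mul_comm]
      exact mul_dvd_mul (by norm_num) key
    · rw [twoDefect_of_ne h2, Nat.sub_zero] at key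
      exact key.mul_left 2
  rw [show (2 * (108 * d ^ 3 * (1 + 2 * d)) : ℤ) = (6 * d) ^ 3 * (1 + 2 * d) by ring, hu2, mul_pow,
    ← pow_mul, mul_comm m 3, mul_assoc, pow_succ] at key2
  have key3 := (mul_dvd_mul_iff_left (pow_ne_zero _ hp'.ne_zero)).mp key2
  rcases hp'.dvd_or_dvd key3 with h | h
  · exact hu' (by exact_mod_cast hp'.dvd_of_dvd_pow h)
  · exact hd (by exact_mod_cast h)

/-- Here `1 + 2 * d` is divisible by `3`, so the general estimate fails. Up to the factor `-a`, the
exponent is `(a - 2) * a ^ a + 1` for `k = 1` and `(a ^ 2 - a - 1) * a ^ (a ^ 2) + 1` for `k = 2`.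
As `r ^ 243 ≡ 1` mod `243`, only residues modulo `243` matter, and for each of them one of the two
choices works. -/
theorem not_pow_dvd_fundamental_of_mod_nine {a : ℕ} (ha : a % 9 = 7) :
    ∃ k M : ℕ, (M : ℤ) = (a : ℤ) ^ k ∧
      ¬ (3 : ℤ) ^ 5 ∣ (a - 1 : ℤ) * (powSum a M - (a : ℤ) ^ (k + M)) := by
  have key : ∀ r < 243, r % 9 = 7 → r ^ 243 % 243 = 1 ∧
      ((r * ((r - 2) * r ^ r + 1)) % 243 ≠ 0 ∨
        (r * ((r * r - r - 1) * r ^ (r * r % 243) + 1)) % 243 ≠ 0) := by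
    decide +kernel
  obtain ⟨h1, h2⟩ := key (a % 243) (Nat.mod_lt _ (by norm_num)) (by omega)
  set r := a % 243 with hr
  have hr7 : 7 ≤ r := by omega
  have har : a ≡ r [MOD 243] := (Nat.mod_modEq a 243).symm
  have hpow : ∀ x y : ℕ, x ≡ y [MOD 243] → a ^ x ≡ r ^ y [MOD 243] := by
    have h3 : ∀ x : ℕ, r ^ x ≡ r ^ (x % 243) [MOD 243] := fun x => by
      conv_lhs => rw [← Nat.div_add_mod x 243, pow_add, pow_mul]
      have h4 : r ^ 243 ≡ 1 [MOD 243] := h1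
      simpa using (h4.pow (x / 243)).mul_right (r ^ (x % 243))
    intro x y hxy
    have h5 : x % 243 = y % 243 := hxy
    exact (har.pow x).trans ((h3 x).trans (h5 ▸ (h3 y).symm))
  rcases h2 with h2 | h2
  · refine ⟨1, a, by simp, fun hdvd => h2 ?_⟩
    have h3 : a * ((a - 2) * a ^ a + 1) ≡ r * ((r - 2) * r ^ r + 1) [MOD 243] :=
      har.mul (((Nat.ModEq.sub' (iff_of_true (by omega) (by omega)) har (Nat.ModEq.refl 2)).mul
        (hpow a r har)).add_right 1)
    rw [← h3]
    refine Nat.mod_eq_zero_of_dvd ?_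
    have h4 : ((a - 1 : ℤ) * (powSum a a - (a : ℤ) ^ (1 + a))) =
        -((a * ((a - 2) * a ^ a + 1) : ℕ) : ℤ) := by
      push_cast [show 2 ≤ a by omega]
      rw [mul_sub, mul_powSum]
      ring
    rw [h4, dvd_neg] at hdvd
    exact_mod_cast hdvd
  · refine ⟨2, a * a, by push_cast; ring, fun hdvd => h2 ?_⟩
    have hle : a + 1 ≤ a * a := by nlinarith [show 2 ≤ a by omega]
    have hler : r + 1 ≤ r * r := by nlinarith
    have h3 : a * ((a * a - a - 1) * a ^ (a * a) + 1) ≡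
        r * ((r * r - r - 1) * r ^ (r * r % 243) + 1) [MOD 243] :=
      har.mul (((Nat.ModEq.sub' (iff_of_true (by omega) (by omega)) (Nat.ModEq.sub'
        (iff_of_true (by omega) (by omega)) (har.mul har) har) (Nat.ModEq.refl 1)).mul
        (hpow (a * a) (r * r % 243) ((har.mul har).trans (Nat.mod_modEq _ _).symm))).add_right 1)
    rw [← h3]
    refine Nat.mod_eq_zero_of_dvd ?_
    have h4 : ((a - 1 : ℤ) * (powSum a (a * a) - (a : ℤ) ^ (2 + a * a))) =
        -((a * ((a * a - a - 1) * a ^ (a * a) + 1) : ℕ) : ℤ) := by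
      rw [Nat.sub_sub]
      push_cast [hle]
      rw [mul_sub, mul_powSum]
      ring
    rw [h4, dvd_neg] at hdvd
    exact_mod_cast hdvd

/-!
### A permutation model of the Macdonald group for exponents `1 + 6 * d`
-/

-- Up to correction terms in the middle coordinate, a point `(k, s, j)` plays the role of `c ^ k * a
-- ^ (s + j) * b ^ j` under right multiplication. The moduli multiply to `n ^ 7 / 8` with `n = 6 *
-- d`.
namespace MacdonaldModel

/-- Points of the model: residues modulo `18 * d ^ 2`, `108 * d ^ 3` and `18 * d ^ 2`. -/
def rel (d : ℤ) (x y : ℤ × ℤ × ℤ) : Prop :=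
  18 * d ^ 2 ∣ x.1 - y.1 ∧ 108 * d ^ 3 ∣ x.2.1 - y.2.1 ∧ 18 * d ^ 2 ∣ x.2.2 - y.2.2

/-- The equivalence relation whose classes are the points of the model. -/
def setoid (d : ℤ) : Setoid (ℤ × ℤ × ℤ) where
  r := rel d
  iseqv :=
    { refl := fun x => by simp [rel]
      symm := fun h => ⟨(dvd_sub_comm).1 h.1, (dvd_sub_comm).1 h.2.1, (dvd_sub_comm).1 h.2.2⟩
      trans := fun h h' =>
        ⟨by simpa using dvd_add h.1 h'.1, by simpa using dvd_add h.2.1 h'.2.1,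
          by simpa using dvd_add h.2.2 h'.2.2⟩ }

/-- The point set of the model. -/
abbrev Point (d : ℤ) : Type := Quotient (setoid d)

/-- The action of the first generator on representatives. -/
def mapA (d : ℤ) (x : ℤ × ℤ × ℤ) : ℤ × ℤ × ℤ :=
  (x.1 - x.2.2,
    x.2.1 + 1 - 6 * d * x.2.2 * (x.2.1 + x.2.2 + 1) - 3 * d * x.2.2 ^ 2
      - 18 * d ^ 2 * x.2.2 * x.1 + 18 * d ^ 2 * x.2.2 * (x.2.2 + 1) * (x.2.1 + x.2.2 + 1)
      - 6 * d ^ 2 * (x.2.2 ^ 3 - x.2.2),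
    x.2.2 + 3 * d * x.2.2 * (x.2.2 + 1))

/-- The action of the second generator on representatives. -/
def mapB (x : ℤ × ℤ × ℤ) : ℤ × ℤ × ℤ := (x.1, x.2.1 - 1, x.2.2 + 1)

/-- The action of the commutator of the generators on representatives. -/
def mapC (d : ℤ) (x : ℤ × ℤ × ℤ) : ℤ × ℤ × ℤ :=
  (x.1 + 1,
    x.2.1 + 6 * d * x.2.1 + 12 * d * x.2.2 + 18 * d ^ 2 * x.1 - 36 * d ^ 2 * x.2.2 - 3 * d,
    x.2.2 * (1 - 6 * d))

/-- The action of the `l`-th power of the first generator on representatives, where `c₂` and `c₃`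
stand for `l.choose 2` and `l.choose 3`. -/
def flow (d l c₂ c₃ : ℤ) (x : ℤ × ℤ × ℤ) : ℤ × ℤ × ℤ :=
  (x.1 - l * x.2.2 - 3 * d * c₂ * (x.2.2 * (x.2.2 + 1)),
    x.2.1 + l
      + d * (-6 * x.2.2 * (x.2.1 + x.2.2 + 1) * l - 6 * x.2.2 * c₂ - 3 * x.2.2 ^ 2 * l)
      + d ^ 2 * (-18 * (x.2.2 * (x.2.2 + 1)) * (x.2.1 + x.2.2 + 1) * c₂
        - 18 * (x.2.2 * (x.2.2 + 1)) * (2 * c₃ + c₂)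
        + 36 * x.2.2 ^ 2 * (x.2.1 + x.2.2 + 1) * c₂ + 36 * x.2.2 ^ 2 * c₃ + 18 * x.2.2 ^ 3 * c₂
        - 36 * x.2.2 * (x.2.2 * (x.2.2 + 1)) * c₂ - 18 * x.2.2 * x.1 * l + 18 * x.2.2 ^ 2 * c₂
        + 18 * (x.2.2 * (x.2.2 + 1)) * (x.2.1 + x.2.2 + 1) * l
        + 18 * (x.2.2 * (x.2.2 + 1)) * c₂ - 6 * (x.2.2 ^ 3 - x.2.2) * l)
      + 18 * d ^ 3 * (x.2.2 * (x.2.2 + 1)) * c₂,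
    x.2.2 + 3 * d * (x.2.2 * (x.2.2 + 1)) * l)

theorem rel_mapA {d : ℤ} {x y : ℤ × ℤ × ℤ} (h : rel d x y) : rel d (mapA d x) (mapA d y) := by
  obtain ⟨k', s', j'⟩ := x
  obtain ⟨k, s, j⟩ := y
  obtain ⟨⟨u, hu⟩, ⟨v, hv⟩, ⟨w, hw⟩⟩ := h
  simp only at hu hv hw
  obtain rfl : k' = k + 18 * d ^ 2 * u := by linarith
  obtain rfl : s' = s + 108 * d ^ 3 * v := by linarith
  obtain rfl : j' = j + 18 * d ^ 2 * w := by linarith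
  refine ⟨⟨u - w,
    by simp only [mapA]; ring⟩,
    ⟨6 * d * j * s * w - 3 * d * j * u - 6 * d * j * v + 12 * d * j * w + 6 * d * j ^ 2 * w - 3 * d
    * k * w + 3 * d * s * w + 4 * d * w + 18 * d ^ 2 * j * v + 18 * d ^ 2 * j ^ 2 * v - 27 * d ^ 2
    * w ^ 2 + 108 * d ^ 3 * j * w ^ 2 + 54 * d ^ 3 * s * w ^ 2 - 54 * d ^ 3 * u * w - 108 * d ^ 3
    * v * w + 108 * d ^ 3 * w ^ 2 + 648 * d ^ 4 * j * v * w + 324 * d ^ 4 * v * w + 648 * d ^ 5 *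
    w ^ 3 + 5832 * d ^ 6 * v * w ^ 2 - 3 * j * w - s * w + v - w,
    by simp only [mapA]; ring⟩,
    ⟨6 * d * j * w + 3 * d * w + 54 * d ^ 3 * w ^ 2 + w,
    by simp only [mapA]; ring⟩⟩

theorem rel_mapB {d : ℤ} {x y : ℤ × ℤ × ℤ} (h : rel d x y) : rel d (mapB x) (mapB y) := by
  simpa [rel, mapB] using h

theorem rel_mapC {d : ℤ} {x y : ℤ × ℤ × ℤ} (h : rel d x y) : rel d (mapC d x) (mapC d y) := by
  obtain ⟨k', s', j'⟩ := x
  obtain ⟨k, s, j⟩ := y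
  obtain ⟨⟨u, hu⟩, ⟨v, hv⟩, ⟨w, hw⟩⟩ := h
  simp only at hu hv hw
  obtain rfl : k' = k + 18 * d ^ 2 * u := by linarith
  obtain rfl : s' = s + 108 * d ^ 3 * v := by linarith
  obtain rfl : j' = j + 18 * d ^ 2 * w := by linarith
  refine ⟨⟨u,
    by simp only [mapC]; ring⟩,
    ⟨3 * d * u + 6 * d * v - 6 * d * w + v + 2 * w,
    by simp only [mapC]; ring⟩,
    ⟨-6 * d * w + w,
    by simp only [mapC]; ring⟩⟩

/-- Integers that behave like the binomial coefficients `(j + 1).choose 2`, `(j + 1).choose 3` and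
`(j + 2).choose 4`. -/
theorem exists_binomials (j : ℤ) :
    ∃ e f g : ℤ, j ^ 2 = 2 * e - j ∧ j * e = 3 * f + e ∧ j * f = 4 * g - 2 * f := by
  obtain ⟨e, he⟩ := (Int.even_mul_succ_self j).two_dvd
  have h3 : (3 : ℤ) ∣ (j - 1) * e := by
    have h : (3 : ℤ) ∣ 2 * ((j - 1) * e) := by
      have h : 2 * ((j - 1) * e) = (j - 1) * j * (j + 1) := by linear_combination -(j - 1) * he
      rw [h]
      rcases (by omega : j % 3 = 0 ∨ j % 3 = 1 ∨ j % 3 = 2) with h | h | h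
      · exact Dvd.dvd.mul_right (Dvd.dvd.mul_left (by omega) _) _
      · exact Dvd.dvd.mul_right (Dvd.dvd.mul_right (by omega) _) _
      · exact Dvd.dvd.mul_left (by omega) _
    omega
  obtain ⟨f, hf⟩ := h3
  have h4 : (4 : ℤ) ∣ (j + 2) * f := by
    have h : (4 : ℤ) ∣ 3 * ((j + 2) * f) := by
      have hee : 3 * ((j + 2) * f) = 2 * (e * (e - 1)) := by
        linear_combination -(j + 2) * hf + e * he
      obtain ⟨t, ht⟩ := (Int.even_mul_pred_self e).two_dvd
      exact ⟨t, by rw [hee, ht]; ring⟩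
    omega
  obtain ⟨g, hg⟩ := h4
  exact ⟨e, f, g, by linear_combination he, by linear_combination hf, by linear_combination hg⟩

set_option maxHeartbeats 2000000 in
-- the witness is a large polynomial
theorem rel_mapA_flow (d l c2 c3 : ℤ) (hl : l ^ 2 = 2 * c2 + l) (hlc : l * c2 = 3 * c3 + 2 * c2)
    (x : ℤ × ℤ × ℤ) :
    rel d (mapA d (flow d l c2 c3 x)) (flow d (l + 1) (c2 + l) (c3 + c2) x) := by
  obtain ⟨k, s, j⟩ := x
  -- The quotient by `108 * d ^ 3` is not an integral polynomial in `j` alone; it becomes integral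
  -- once binomial coefficients in `j` are allowed.
  obtain ⟨e, f, g, he, hf, hg⟩ := exists_binomials j
  refine ⟨⟨0,
    by simp only [mapA, flow]; ring⟩,
    ⟨(((2 * c3 * j ^ 2) + l * (e * j - e * j ^ 2 + e * k + e * s - f + 2 * g + j - j * k - j ^ 2 *
    s - j ^ 3 - j ^ 3 * s - j ^ 4) + l ^ 2 * (2 * j ^ 2 + j ^ 2 * s + 2 * j ^ 3 + j ^ 3 * s + j ^
    4)) + c2 * ((2 * e + 2 * e * j + e * j ^ 2 - j ^ 2 + j ^ 2 * s - j ^ 3 * s - j ^ 4) + l * (j ^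
    2 + j ^ 3))) + d * (((2 * c3 * e + c3 * e * j + c3 * e * j ^ 2 - c3 * j - 6 * c3 * j ^ 2 - 7 *
    c3 * j ^ 3 + c3 * j ^ 4) + l * (6 * c3 * j ^ 2 + 6 * c3 * j ^ 3 + e + e * j + e * j * s + e *
    j ^ 2 + e * j ^ 2 * s + 2 * e * s - j * s + 3 * j ^ 2 - 3 * j ^ 2 * k + 2 * j ^ 2 * s + 10 * j
    ^ 3 - 3 * j ^ 3 * k + 5 * j ^ 3 * s + 8 * j ^ 4 + 3 * j ^ 4 * s + 2 * j ^ 5) + l ^ 2 * (e + e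
    * j ^ 2 - j - 4 * j ^ 2 + 3 * j ^ 2 * k - 5 * j ^ 2 * s - 16 * j ^ 3 + 3 * j ^ 3 * k - 12 * j
    ^ 3 * s - 19 * j ^ 4 - 8 * j ^ 4 * s - 8 * j ^ 5) + l ^ 3 * (j ^ 2 + 3 * j ^ 3 + j ^ 4)) + c2
    * ((j - 3 * j ^ 2 - 2 * j ^ 2 * s - 5 * j ^ 3 - j ^ 4 + 4 * j ^ 4 * s) + l * (2 * j ^ 2 + 3 *
    j ^ 2 * s - j ^ 4 - 3 * j ^ 4 * s))) + d ^ 2 * ((l * (-18 * c3 * j ^ 2 - 54 * c3 * j ^ 3 - 36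
    * c3 * j ^ 4 + 2 * e + 2 * e * j + e * j ^ 2 + e * j ^ 3 - j - 2 * j ^ 2 - j ^ 3 - j ^ 4) + l
    ^ 2 * (e * j ^ 2 + e * j ^ 4 + 12 * j ^ 2 - 9 * j ^ 2 * k + 9 * j ^ 2 * s + 53 * j ^ 3 - 27 *
    j ^ 3 * k + 36 * j ^ 3 * s + 84 * j ^ 4 - 18 * j ^ 4 * k + 45 * j ^ 4 * s + 53 * j ^ 5 + 18 *
    j ^ 5 * s + 12 * j ^ 6) + l ^ 3 * (-6 * j ^ 3 - 9 * j ^ 3 * s - 23 * j ^ 4 - 18 * j ^ 4 * s -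
    27 * j ^ 5 - 9 * j ^ 5 * s - 11 * j ^ 6)) + c2 * ((3 * j ^ 2 + 7 * j ^ 3 + 3 * j ^ 4 + j ^ 5)
    + l * (-12 * j ^ 2 - 9 * j ^ 2 * s - 42 * j ^ 3 - 18 * j ^ 3 * s - 47 * j ^ 4 + 9 * j ^ 4 * s
    - 18 * j ^ 5 + 18 * j ^ 5 * s + j ^ 6) + l ^ 2 * (-9 * j ^ 3 - 18 * j ^ 4 - 9 * j ^ 5))) + d ^
    3 * ((l ^ 2 * (-54 * c3 * j ^ 3 - 108 * c3 * j ^ 4 - 54 * c3 * j ^ 5) + l ^ 3 * (36 * j ^ 3 -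
    27 * j ^ 3 * k + 27 * j ^ 3 * s + 126 * j ^ 4 - 54 * j ^ 4 * k + 81 * j ^ 4 * s + 162 * j ^ 5
    - 27 * j ^ 5 * k + 81 * j ^ 5 * s + 90 * j ^ 6 + 27 * j ^ 6 * s + 18 * j ^ 7)) + c2 * (l * (9
    * j ^ 2 + 36 * j ^ 3 + 45 * j ^ 4 + 18 * j ^ 5) + l ^ 2 * (-27 * j ^ 3 - 27 * j ^ 3 * s - 81 *
    j ^ 4 - 27 * j ^ 4 * s - 81 * j ^ 5 + 27 * j ^ 5 * s - 27 * j ^ 6 + 27 * j ^ 6 * s))) + d ^ 4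
    * (27 * c2 * j ^ 3 * l ^ 2 + 81 * c2 * j ^ 4 * l ^ 2 + 81 * c2 * j ^ 5 * l ^ 2 + 27 * c2 * j ^
    6 * l ^ 2),
    by simp only [mapA, flow]
       linear_combination (d ^ 2 * (-18 * j - 18 * j ^ 2) + d ^ 3 * (54 * j + 27 * j ^ 2 + 54 * j ^
      3 - 27 * j ^ 4) + d ^ 4 * ((54 * j + 54 * j ^ 2 * s + 108 * j ^ 3 + 54 * j ^ 4 + 54 * j ^ 4
      * s) + l * (54 * j ^ 2 + 54 * j ^ 4)) + d ^ 5 * (54 * j ^ 3 + 54 * j ^ 4 * l + 54 * j ^ 5 +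
      54 * j ^ 6 * l)) * hl + (54 * d ^ 4 * j ^ 2 + 54 * d ^ 4 * j ^ 4) * hlc + (d ^ 3 * ((108 *
      c2 + 108 * c2 * j + 54 * c2 * j ^ 2) + l * (45 * j - 45 * j ^ 2 + 54 * k + 54 * s)) + d ^ 4
      * ((108 * c3 + 54 * c3 * j + 54 * c3 * j ^ 2) + l * (54 + 54 * j + 54 * j * s + 54 * j ^ 2 +
      54 * j ^ 2 * s + 108 * s) + l ^ 2 * (54 + 54 * j ^ 2)) + d ^ 5 * (l * (108 + 108 * j + 54 *
      j ^ 2 + 54 * j ^ 3) + l ^ 2 * (54 * j ^ 2 + 54 * j ^ 4))) * he + (18 * d ^ 3 * j * l) * hf +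
      (54 * d ^ 3 * l) * hg⟩,
    ⟨c2 * d * j ^ 2 + c2 * d * j ^ 4 + d * e * j * l + d * e * j ^ 2 * l + 2 * d * e * l - d * j *
    l - d * j ^ 2 * l + d * j ^ 2 * l ^ 2 - d * j ^ 3 * l + 3 * d * j ^ 3 * l ^ 2 + d * j ^ 4 * l
    ^ 2 + e * l + j ^ 2 * l + j ^ 3 * l,
    by simp only [mapA, flow]
       linear_combination (9 * d ^ 3 * j ^ 2 + 9 * d ^ 3 * j ^ 4) * hl + (9 * d ^ 2 * l + 9 * d ^ 3
      * j * l + 9 * d ^ 3 * j ^ 2 * l + 18 * d ^ 3 * l) * he⟩⟩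

/-- The relation `a * c = c * a ^ α` for right actions; the last two parameters of `flow` are the
binomial coefficients of `α = 1 + 6 * d` over `2` and `3`. -/
theorem rel_mapC_mapA (d : ℤ) (x : ℤ × ℤ × ℤ) :
    rel d (mapC d (mapA d x))
      (flow d (1 + 6 * d) (3 * d * (1 + 6 * d)) (d * (6 * d + 1) * (6 * d - 1)) (mapC d x)) := by
  obtain ⟨k, s, j⟩ := x
  obtain ⟨e, f, g, he, hf, hg⟩ := exists_binomials j
  refine ⟨⟨-3 * d * j ^ 2 - 18 * d ^ 2 * j - 18 * d ^ 2 * j ^ 2 + 108 * d ^ 3 * j ^ 2 + e - 2 * j,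
    by simp only [mapA, mapC, flow]
       linear_combination (9 * d ^ 2) * he⟩,
    ⟨(e * s - j - 2 * j * s - 3 * j ^ 2) + d * (((2 * j - 9 * j * k - 3 * j * s + 13 * j ^ 2 - 3 *
    j ^ 2 * k + 12 * j ^ 2 * s + 12 * j ^ 3))) + d ^ 2 * (((-24 * j - 27 * j * k + 18 * j * s + 12
    * j ^ 2 + 9 * j ^ 2 * k + 36 * j ^ 2 * s + 42 * j ^ 3))) + d ^ 3 * (((108 * j * k - 108 * j *
    s - 252 * j ^ 2 + 162 * j ^ 2 * k - 216 * j ^ 2 * s - 396 * j ^ 3))) + d ^ 4 * (((-324 * j * k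
    + 864 * j ^ 2 - 324 * j ^ 2 * k - 648 * j ^ 2 * s - 648 * j ^ 3))) + d ^ 5 * (-1944 * j ^ 2 *
    k + 3888 * j ^ 3),
    by simp only [mapA, mapC, flow]
       linear_combination (54 * d ^ 3 * s) * he⟩,
    ⟨6 * d * j + 6 * d * j ^ 2 - 36 * d ^ 2 * j ^ 2 - j,
    by simp only [mapA, mapC, flow]; ring⟩⟩

theorem rel_mapB_mapA (d : ℤ) (x : ℤ × ℤ × ℤ) :
    rel d (mapB (mapA d x)) (mapC d (mapA d (mapB x))) := by
  obtain ⟨k, s, j⟩ := x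
  obtain ⟨e, f, g, he, hf, hg⟩ := exists_binomials j
  refine ⟨⟨0,
    by simp only [mapA, mapB, mapC]; ring⟩,
    ⟨-e + e * j - f - j + j * k - 3 * j * s - 2 * j ^ 2 - j ^ 2 * s - j ^ 3 + k - 2 * s,
    by simp only [mapA, mapB, mapC]
       linear_combination (-36 * d ^ 3 + 36 * d ^ 3 * j) * he + (-36 * d ^ 3) * hf⟩,
    ⟨2 + 3 * j + j ^ 2,
    by simp only [mapA, mapB, mapC]; ring⟩⟩

theorem rel_mapB_mapC (d : ℤ) (x : ℤ × ℤ × ℤ) :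
    rel d (mapB (mapC d x)) (mapC d (x.1, x.2.1 - (1 + 6 * d), x.2.2 + (1 + 6 * d))) := by
  obtain ⟨k, s, j⟩ := x
  refine ⟨⟨0,
    by simp only [mapB, mapC]; ring⟩,
    ⟨2,
    by simp only [mapB, mapC]; ring⟩,
    ⟨2,
    by simp only [mapB, mapC]; ring⟩⟩

theorem rel_flow_self (d u v w : ℤ) (x : ℤ × ℤ × ℤ) :
    rel d (flow d (108 * d ^ 3 * u) (108 * d ^ 3 * v) (108 * d ^ 3 * w) x) x := by
  obtain ⟨k, s, j⟩ := x
  refine ⟨⟨-6 * d * j * u - 18 * d ^ 2 * j * v - 18 * d ^ 2 * j ^ 2 * v,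
    by simp only [flow]; ring⟩,
    ⟨-6 * d * j * s * u - 6 * d * j * u - 6 * d * j * v - 9 * d * j ^ 2 * u - 18 * d ^ 2 * j * k *
    u + 18 * d ^ 2 * j * s * u - 18 * d ^ 2 * j * s * v + 24 * d ^ 2 * j * u - 18 * d ^ 2 * j * v
    - 36 * d ^ 2 * j * w + 18 * d ^ 2 * j ^ 2 * s * u + 18 * d ^ 2 * j ^ 2 * s * v + 36 * d ^ 2 *
    j ^ 2 * u - 18 * d ^ 2 * j ^ 2 * v + 12 * d ^ 2 * j ^ 3 * u + 18 * d ^ 3 * j * v + 18 * d ^ 3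
    * j ^ 2 * v + u,
    by simp only [flow]; ring⟩,
    ⟨18 * d ^ 2 * j * u + 18 * d ^ 2 * j ^ 2 * u,
    by simp only [flow]; ring⟩⟩

/-- The action of the first generator. -/
def actA (d : ℤ) : Point d → Point d := Quotient.map (mapA d) fun _ _ h => rel_mapA h

/-- The action of the second generator. -/
def actB (d : ℤ) : Point d → Point d := Quotient.map mapB fun _ _ h => rel_mapB h

/-- The action of the commutator of the generators. -/
def actC (d : ℤ) : Point d → Point d := Quotient.map (mapC d) fun _ _ h => rel_mapC h

/-- The class of a triple of integers. -/
def point (d : ℤ) (x : ℤ × ℤ × ℤ) : Point d := Quotient.mk _ x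

theorem point_eq_iff {d : ℤ} {x y : ℤ × ℤ × ℤ} : point d x = point d y ↔ rel d x y :=
  Quotient.eq (r := setoid d)

theorem exists_rep {d : ℤ} (y : Point d) : ∃ x, point d x = y := Quotient.exists_rep y

theorem actA_point (d : ℤ) (x : ℤ × ℤ × ℤ) : actA d (point d x) = point d (mapA d x) := rfl

theorem actB_point (d : ℤ) (x : ℤ × ℤ × ℤ) : actB d (point d x) = point d (mapB x) := rfl

theorem actC_point (d : ℤ) (x : ℤ × ℤ × ℤ) : actC d (point d x) = point d (mapC d x) := rfl

theorem choose_two_rel (l : ℕ) : (l : ℤ) ^ 2 = 2 * (l.choose 2 : ℕ) + l := by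
  induction l with
  | zero => simp
  | succ l ih =>
    rw [Nat.choose_succ_succ', Nat.choose_one_right]
    push_cast
    linear_combination ih

theorem choose_three_rel (l : ℕ) :
    (l : ℤ) * (l.choose 2 : ℕ) = 3 * (l.choose 3 : ℕ) + 2 * (l.choose 2 : ℕ) := by
  induction l with
  | zero => simp
  | succ l ih =>
    have h := choose_two_rel l
    rw [Nat.choose_succ_succ', Nat.choose_succ_succ' l 2, Nat.choose_one_right]
    push_cast
    linear_combination ih + h

theorem actA_iterate (d : ℤ) (l : ℕ) (x : ℤ × ℤ × ℤ) :
    (actA d)^[l] (point d x) = point d (flow d l (l.choose 2 : ℕ) (l.choose 3 : ℕ) x) := by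
  induction l with
  | zero => simp [flow]
  | succ l ih =>
    rw [Function.iterate_succ_apply', ih, actA_point, point_eq_iff]
    have := rel_mapA_flow d l _ _ (choose_two_rel l) (choose_three_rel l) x
    rw [Nat.choose_succ_succ' l 2, Nat.choose_succ_succ' l 1, Nat.choose_one_right]
    push_cast
    rwa [add_comm (l : ℤ) (l.choose 2 : ℤ), add_comm ((l.choose 2 : ℕ) : ℤ) (l.choose 3 : ℤ)]

theorem actB_iterate (d : ℤ) (l : ℕ) (x : ℤ × ℤ × ℤ) :
    (actB d)^[l] (point d x) = point d (x.1, x.2.1 - l, x.2.2 + l) := by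
  induction l with
  | zero => simp
  | succ l ih =>
    rw [Function.iterate_succ_apply', ih, actB_point]
    simp only [mapB]
    push_cast
    congr 3 <;> ring

theorem actA_iterate_period (d : ℕ) : (actA d)^[6 * (108 * d ^ 3)] = id := by
  funext y
  obtain ⟨x, rfl⟩ := exists_rep y
  rw [actA_iterate, id, point_eq_iff]
  -- The factor `6` makes the binomial coefficients of `6 * N` over `2` and `3` multiples of `N`.
  -- Any period would do, since it only serves to prove bijectivity.
  set N : ℤ := 108 * (d : ℤ) ^ 3 with hN
  have h2 := choose_two_rel (6 * (108 * d ^ 3))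
  have h3 := choose_three_rel (6 * (108 * d ^ 3))
  have hl : ((6 * (108 * d ^ 3) : ℕ) : ℤ) = N * 6 := by push_cast; rw [hN]; ring
  rw [hl] at h2 h3 ⊢
  have e2 : (((6 * (108 * d ^ 3)).choose 2 : ℕ) : ℤ) = N * (3 * (6 * N - 1)) := by linarith
  have e3 : (((6 * (108 * d ^ 3)).choose 3 : ℕ) : ℤ) = N * ((6 * N - 1) * (6 * N - 2)) := by
    rw [e2] at h3
    linarith
  rw [e2, e3]
  exact rel_flow_self d _ _ _ x

theorem actB_iterate_period (d : ℕ) : (actB d)^[108 * d ^ 3] = id := by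
  funext y
  obtain ⟨x, rfl⟩ := exists_rep y
  rw [actB_iterate, id, point_eq_iff]
  push_cast
  exact ⟨by simp, ⟨-1, by ring⟩, ⟨6 * d, by ring⟩⟩

theorem bijective_of_iterate_eq_id {X : Type*} {f : X → X} {n : ℕ} (hn : n ≠ 0)
    (h : f^[n] = id) : Function.Bijective f := by
  obtain ⟨n, rfl⟩ := Nat.exists_eq_succ_of_ne_zero hn
  constructor
  · refine Function.Injective.of_comp (f := f^[n]) ?_
    rw [← Function.iterate_succ, h]
    exact Function.injective_id
  · refine Function.Surjective.of_comp (g := f^[n]) ?_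
    rw [← Function.iterate_succ', h]
    exact Function.surjective_id

end MacdonaldModel

/-- A triple of maps satisfying the Macdonald relations for right actions yields a Macdonald triple
of permutations. -/
theorem exists_macdonaldTriple_of_maps {X : Type*} {A B C : X → X} {n : ℕ}
    (hA : Function.Bijective A) (hB : Function.Bijective B)
    (hBA : ∀ x, B (A x) = C (A (B x))) (hCA : ∀ x, C (A x) = A^[n] (C x))
    (hBC : ∀ x, B (C x) = C (B^[n] x)) :
    ∃ a b c : (Equiv.Perm X)ᵐᵒᵖ, MacdonaldTriple (n : ℤ) a b c ∧
      (∀ (l : ℕ) (x : X), (a ^ l).unop x = A^[l] x) ∧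
        ∀ (l : ℕ) (x : X), (b ^ l).unop x = B^[l] x := by
  set σ : Equiv.Perm X := Equiv.ofBijective A hA with hσ
  set τ : Equiv.Perm X := Equiv.ofBijective B hB with hτ
  have h1 : ∀ x, σ x = A x := fun x => rfl
  have h2 : ∀ x, τ x = B x := fun x => rfl
  have hpow : ∀ (l : ℕ) (x : X), (σ ^ l) x = A^[l] x := fun l x => by
    rw [Equiv.Perm.coe_pow]; rfl
  have hpow' : ∀ (l : ℕ) (x : X), (τ ^ l) x = B^[l] x := fun l x => by
    rw [Equiv.Perm.coe_pow]; rfl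
  set ρ : Equiv.Perm X := τ * σ * (σ * τ)⁻¹ with hρ
  have h3 : ∀ x, ρ x = C x := by
    intro x
    obtain ⟨z, rfl⟩ := (σ * τ).surjective x
    rw [hρ, ← Equiv.Perm.mul_apply, inv_mul_cancel_right]
    exact hBA z
  refine ⟨.op σ, .op τ, .op ρ, ⟨?_, ?_, ?_⟩, fun l x => ?_, fun l x => ?_⟩
  · rw [← MulOpposite.op_mul, ← MulOpposite.op_mul, ← MulOpposite.op_mul, MulOpposite.op_inj]
    ext x
    simp only [Equiv.Perm.mul_apply, h1, h2, h3, hBA]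
  · rw [zpow_natCast, ← MulOpposite.op_pow, ← MulOpposite.op_mul, ← MulOpposite.op_mul,
      MulOpposite.op_inj]
    ext x
    simp only [Equiv.Perm.mul_apply, h1, h3, hpow, hCA]
  · rw [zpow_natCast, ← MulOpposite.op_pow, ← MulOpposite.op_mul, ← MulOpposite.op_mul,
      MulOpposite.op_inj]
    ext x
    simp only [Equiv.Perm.mul_apply, h2, h3, hpow', hBC]
  · rw [← MulOpposite.op_pow, MulOpposite.unop_op, hpow]
  · rw [← MulOpposite.op_pow, MulOpposite.unop_op, hpow']

open MacdonaldModel in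
/-- For `α = 1 + 6 * d` there is a group generated by a Macdonald triple in which the orders of the
generators are multiples of `108 * d ^ 3`. -/
theorem exists_macdonaldTriple_of_six_mul {d : ℕ} (hd : d ≠ 0) :
    ∃ (T : Type) (_ : Group T) (a b c : T), MacdonaldTriple (1 + 6 * d : ℤ) a b c ∧
      108 * d ^ 3 ∣ orderOf a ∧ 108 * d ^ 3 ∣ orderOf b := by
  have hN : 108 * d ^ 3 ≠ 0 := by positivity
  have hA := bijective_of_iterate_eq_id (by positivity) (actA_iterate_period d)
  have hB := bijective_of_iterate_eq_id hN (actB_iterate_period d)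
  have hBA : ∀ x, actB d (actA d x) = actC d (actA d (actB d x)) := by
    intro y
    obtain ⟨x, rfl⟩ := exists_rep y
    simp only [actA_point, actB_point, actC_point, point_eq_iff]
    exact rel_mapB_mapA d x
  have hCA : ∀ x, actC d (actA d x) = (actA d)^[1 + 6 * d] (actC d x) := by
    intro y
    obtain ⟨x, rfl⟩ := exists_rep y
    rw [actA_point, actC_point, actC_point, actA_iterate, point_eq_iff]
    have h2 := choose_two_rel (1 + 6 * d)
    have h3 := choose_three_rel (1 + 6 * d)
    push_cast at h2 h3 ⊢
    have e2 : (((1 + 6 * d).choose 2 : ℕ) : ℤ) = 3 * d * (1 + 6 * d) := by linarith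
    have e3 : (((1 + 6 * d).choose 3 : ℕ) : ℤ) = d * (6 * d + 1) * (6 * d - 1) := by
      rw [e2] at h3
      linarith
    rw [e2, e3]
    exact rel_mapC_mapA d x
  have hBC : ∀ x, actB d (actC d x) = actC d ((actB d)^[1 + 6 * d] x) := by
    intro y
    obtain ⟨x, rfl⟩ := exists_rep y
    rw [actC_point, actB_iterate, actB_point, actC_point, point_eq_iff]
    push_cast
    exact rel_mapB_mapC d x
  obtain ⟨a, b, c, h, ha, hb⟩ := exists_macdonaldTriple_of_maps hA hB hBA hCA hBC
  refine ⟨_, inferInstance, a, b, c, by exact_mod_cast h, ?_, ?_⟩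
  -- At the origin the `l`-th power of the first generator moves the middle coordinate to exactly
  -- `l`, so the order is a multiple of its modulus.
  · have h0 := ha (orderOf a) (point d (0, 0, 0))
    rw [pow_orderOf_eq_one, actA_iterate, MulOpposite.unop_one, Equiv.Perm.one_apply, eq_comm,
      point_eq_iff] at h0
    have := h0.2.1
    simp [flow] at this
    exact_mod_cast this
  · have h0 := hb (orderOf b) (point d (0, 0, 0))
    rw [pow_orderOf_eq_one, actB_iterate, MulOpposite.unop_one, Equiv.Perm.one_apply, eq_comm,
      point_eq_iff] at h0
    have := h0.2.1
    simp at this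
    exact_mod_cast this

/-!
### Permutation models of the Macdonald group of exponent `81`
-/

/-- Fibrewise affine maps `(s, j) ↦ (u j * s + v j, t j)` of `ZMod 81 × ZMod 27`, acting on encoded
affine sections `s ↦ (U * s + V, J)`. The map is given as `f j = (u j, v j, t j)`. -/
def affineStep (f : ℕ → ℕ × ℕ × ℕ) (p : ℕ × ℕ × ℕ) : ℕ × ℕ × ℕ :=
  ((f p.2.2).1 * p.1 % 81, ((f p.2.2).1 * p.2.1 + (f p.2.2).2.1) % 81, (f p.2.2).2.2 % 27)

/-- The map of `ZMod 81 × Fin 27` described by `f`. -/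
def affineMap (f : ℕ → ℕ × ℕ × ℕ) (x : ZMod 81 × Fin 27) : ZMod 81 × Fin 27 :=
  ((f x.2).1 * x.1 + (f x.2).2.1, Fin.ofNat 27 (f x.2).2.2)

/-- The point at parameter `s` of an affine section. -/
def affineEval (p : ℕ × ℕ × ℕ) (s : ZMod 81) : ZMod 81 × Fin 27 :=
  (p.1 * s + p.2.1, Fin.ofNat 27 p.2.2)

/-- Affine sections are mapped to affine sections, so identities between such maps need checking
only on the `27` sections `(1, 0, j)`, in machine arithmetic on naturals. -/
theorem affineMap_eval (f : ℕ → ℕ × ℕ × ℕ) {p : ℕ × ℕ × ℕ} (hp : p.2.2 < 27) (s : ZMod 81) :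
    affineMap f (affineEval p s) = affineEval (affineStep f p) s := by
  have h : ((Fin.ofNat 27 p.2.2 : Fin 27) : ℕ) = p.2.2 := Nat.mod_eq_of_lt hp
  simp only [affineMap, affineEval, affineStep, h, ZMod.natCast_mod]
  refine Prod.ext ?_ ?_
  · push_cast
    ring
  · ext
    simp [Fin.ofNat]

theorem affineMap_iterate_eval (f : ℕ → ℕ × ℕ × ℕ) {p : ℕ × ℕ × ℕ} (hp : p.2.2 < 27)
    (s : ZMod 81) (n : ℕ) :
    (affineMap f)^[n] (affineEval p s) = affineEval ((affineStep f)^[n] p) s ∧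
      ((affineStep f)^[n] p).2.2 < 27 := by
  induction n with
  | zero => exact ⟨rfl, hp⟩
  | succ n ih =>
    rw [Function.iterate_succ_apply', Function.iterate_succ_apply', ih.1,
      affineMap_eval f ih.2]
    exact ⟨rfl, Nat.mod_lt _ (by norm_num)⟩

theorem affineEval_one_zero (x : ZMod 81 × Fin 27) : affineEval (1, 0, x.2) x.1 = x := by
  refine Prod.ext ?_ ?_
  · simp [affineEval]
  · ext
    simp [affineEval, Fin.ofNat, Nat.mod_eq_of_lt x.2.2]

/-- The action of the first generator; `α ^ 26` is the inverse of `α` modulo `81`. -/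
def sectionA (α : ℕ) (j : ℕ) : ℕ × ℕ × ℕ :=
  -- The point `(s, j)` stands for the coset of `⟨c⟩` containing `a ^ (s + j) * b ^ j`, and the
  -- formula is `b ^ j * a = a * c ^ (-j) * b ^ powSum α j`. Here `80` is `-1` modulo `81`, and `α *
  -- ((α ^ j - 1) / (α - 1))` is `powSum α j`.
  ((α ^ 26 % 81) ^ j % 81, (j + 1) * ((α ^ 26 % 81) ^ j % 81) + 80 * (α * ((α ^ j - 1) / (α - 1))),
    α * ((α ^ j - 1) / (α - 1)))

/-- The action of the second generator. -/
def sectionB (j : ℕ) : ℕ × ℕ × ℕ := (1, 80, j + 1)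

/-- The action of the commutator of the generators. -/
def sectionC (α : ℕ) (j : ℕ) : ℕ × ℕ × ℕ :=
  (α, j * (α + 80 * (α ^ 26 % 81)), j * (α ^ 26 % 81))

/-- The Macdonald relations, and periodicity, on affine sections. -/
def SectionRelations (α : ℕ) : Prop :=
  ∀ j < 27,
    affineStep sectionB (affineStep (sectionA α) (1, 0, j)) =
      affineStep (sectionC α) (affineStep (sectionA α) (affineStep sectionB (1, 0, j))) ∧
    affineStep (sectionC α) (affineStep (sectionA α) (1, 0, j)) =
      (affineStep (sectionA α))^[α] (affineStep (sectionC α) (1, 0, j)) ∧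
    affineStep sectionB (affineStep (sectionC α) (1, 0, j)) =
      affineStep (sectionC α) ((affineStep sectionB)^[α] (1, 0, j)) ∧
    (affineStep (sectionA α))^[81] (1, 0, j) = (1, 0, j) ∧
    (affineStep sectionB)^[81] (1, 0, j) = (1, 0, j)

instance (α : ℕ) : Decidable (SectionRelations α) := by
  unfold SectionRelations
  infer_instance

theorem sectionRelations : ∀ t < 9, SectionRelations (7 + 9 * t) := by
  decide +kernel

theorem exists_macdonaldTriple_of_sectionRelations {α : ℕ} (h : SectionRelations α) :
    ∃ (T : Type) (_ : Group T) (a b c : T), MacdonaldTriple (α : ℤ) a b c ∧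
      81 ∣ orderOf a ∧ 81 ∣ orderOf b := by
  have key : ∀ x : ZMod 81 × Fin 27, ∀ f,
      affineMap f x = affineEval (affineStep f (1, 0, x.2)) x.1 :=
    fun x f => by rw [← affineMap_eval f x.2.2, affineEval_one_zero]
  have keyi : ∀ x : ZMod 81 × Fin 27, ∀ f, ∀ n, (affineMap f)^[n] x =
      affineEval ((affineStep f)^[n] (1, 0, x.2)) x.1 :=
    fun x f n => by rw [← (affineMap_iterate_eval f x.2.2 x.1 n).1, affineEval_one_zero]
  have hlt : ∀ f p, (affineStep f p).2.2 < 27 := fun f p => Nat.mod_lt _ (by norm_num)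
  have hA : Function.Bijective (affineMap (sectionA α)) := by
    refine MacdonaldModel.bijective_of_iterate_eq_id (n := 81) (by norm_num) (funext fun x => ?_)
    rw [keyi, (h x.2 x.2.2).2.2.2.1, affineEval_one_zero, id]
  have hB : Function.Bijective (affineMap sectionB) := by
    refine MacdonaldModel.bijective_of_iterate_eq_id (n := 81) (by norm_num) (funext fun x => ?_)
    rw [keyi, (h x.2 x.2.2).2.2.2.2, affineEval_one_zero, id]
  obtain ⟨a, b, c, hT, ha, hb⟩ := exists_macdonaldTriple_of_maps (C := affineMap (sectionC α))
    (n := α) hA hB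
    (fun x => by
      rw [key x (sectionA α), key x sectionB, affineMap_eval _ (hlt _ _), affineMap_eval _ (hlt _ _),
        affineMap_eval _ (hlt _ _), (h x.2 x.2.2).1])
    (fun x => by
      rw [key x (sectionA α), key x (sectionC α), affineMap_eval _ (hlt _ _),
        (affineMap_iterate_eval _ (hlt _ _) _ _).1, (h x.2 x.2.2).2.1])
    (fun x => by
      have h1 := (affineMap_iterate_eval sectionB (p := (1, 0, x.2)) x.2.2 x.1 α).2
      rw [key x (sectionC α), keyi x, affineMap_eval _ (hlt _ _), affineMap_eval _ h1,
        (h x.2 x.2.2).2.2.1])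
  have hAn : ∀ n : ℕ, (affineMap (sectionA α))^[n] (0, 0) = ((n : ZMod 81), 0) := by
    intro n
    induction n with
    | zero => simp
    | succ n ih =>
      rw [Function.iterate_succ_apply', ih]
      simp [affineMap, sectionA]
  have hBn : ∀ n : ℕ, ((affineMap sectionB)^[n] (0, 0)).1 = -(n : ZMod 81) := by
    intro n
    induction n with
    | zero => simp
    | succ n ih =>
      rw [Function.iterate_succ_apply']
      simp only [affineMap, sectionB, ih]
      have : ((80 : ℕ) : ZMod 81) = -1 := by decide
      rw [this]
      push_cast
      ring
  refine ⟨_, inferInstance, a, b, c, hT, ?_, ?_⟩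
  · have h0 := ha (orderOf a) (0, 0)
    rw [pow_orderOf_eq_one, hAn, MulOpposite.unop_one, Equiv.Perm.one_apply, Prod.mk.injEq] at h0
    exact (ZMod.natCast_eq_zero_iff _ _).1 h0.1.symm
  · have h0 := congrArg Prod.fst (hb (orderOf b) (0, 0))
    rw [pow_orderOf_eq_one, hBn, MulOpposite.unop_one, Equiv.Perm.one_apply, eq_comm,
      neg_eq_zero] at h0
    exact (ZMod.natCast_eq_zero_iff _ _).1 h0

/-- For `α ≡ 7` modulo `9` there is a group generated by a Macdonald triple in which the orders of
the generators are multiples of `81`. -/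
theorem exists_macdonaldTriple_of_mod_nine {α : ℕ} (hα : α % 9 = 7) :
    ∃ α' : ℕ, (81 : ℤ) ∣ (α' : ℤ) - α ∧
      ∃ (T : Type) (_ : Group T) (a b c : T), MacdonaldTriple (α' : ℤ) a b c ∧
        81 ∣ orderOf a ∧ 81 ∣ orderOf b :=
  ⟨7 + 9 * (α % 81 / 9), by omega, exists_macdonaldTriple_of_sectionRelations
    (sectionRelations _ (by omega))⟩

/-!
### Sylow subgroups of the Macdonald group
-/

/-- The gcd of `6` and `p ^ S` is `1` or `p`, so it divides `α - 1`, and Bézout solves the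
congruence. A multiple of `p ^ S` is added to keep `d` nonzero. -/
theorem exists_six_mul_congr {p : ℕ} (hp : p.Prime) {α : ℤ} (hα : (p : ℤ) ∣ α - 1) (S : ℕ) :
    ∃ d : ℕ, d ≠ 0 ∧ (p : ℤ) ^ S ∣ α - (1 + 6 * d) := by
  have hg : ((Nat.gcd 6 (p ^ S) : ℕ) : ℤ) ∣ α - 1 := by
    refine (Int.natCast_dvd_natCast.2 ?_).trans hα
    obtain ⟨j, -, hj⟩ := (Nat.dvd_prime_pow hp).1 (Nat.gcd_dvd_right 6 (p ^ S))
    have h6 := Nat.gcd_dvd_left 6 (p ^ S)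
    rw [hj] at h6 ⊢
    have hj2 : j < 2 := by
      by_contra hj2
      have h1 : p ^ 2 ∣ 6 := (pow_dvd_pow p (by omega)).trans h6
      have h2 : p ≤ 2 := by nlinarith [Nat.le_of_dvd (by norm_num) h1]
      obtain rfl : p = 2 := le_antisymm h2 hp.two_le
      omega
    interval_cases j
    · simp
    · simp
  obtain ⟨t, ht⟩ := hg
  have hb := Nat.gcd_eq_gcd_ab 6 (p ^ S)
  set x := Nat.gcdA 6 (p ^ S)
  set y := Nat.gcdB 6 (p ^ S)
  have hpos : (0 : ℤ) < (p : ℤ) ^ S := by have := hp.pos; positivity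
  have hmod := Int.emod_nonneg (x * t) hpos.ne'
  refine ⟨((x * t) % (p : ℤ) ^ S + (p : ℤ) ^ S).toNat, by omega, ?_⟩
  rw [Int.toNat_of_nonneg (by omega)]
  refine ⟨y * t + 6 * (x * t / (p : ℤ) ^ S) - 6, ?_⟩
  have hdm := Int.emod_add_mul_ediv (x * t) ((p : ℤ) ^ S)
  push_cast at hb
  linear_combination ht + t * hb - 6 * hdm

namespace MacdonaldTriple

variable {T : Type*} [Group T] {α : ℤ} {a b c : T} {p m h : ℕ}

theorem pow_left_of_sub_one_exact (H : MacdonaldTriple α a b c) (hp : p.Prime) (hm : 1 ≤ m)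
    (hn : (p : ℤ) ^ m ∣ α - 1) (hn' : ¬ (p : ℤ) ^ (m + 1) ∣ α - 1)
    (hthree : p = 3 → m = 1 → α % 9 = 4) (hh : h + twoDefect p = 2 * m) {s : ℕ}
    (ha : a ^ p ^ s = 1) (hb : b ^ p ^ s = 1) :
    a ^ p ^ (h + m) = 1 ∧ ∃ x : ℤ, a ^ p ^ h = b ^ x := by
  have hpn : (p : ℤ) ∣ α - 1 := (dvd_pow_self _ (by omega)).trans hn
  obtain ⟨d, -, hd⟩ := exists_six_mul_congr hp hpn (s + m + 1)
  have hd1 : (p : ℤ) ^ (m + 1) ∣ α - (1 + 6 * d) := (pow_dvd_pow _ (by omega)).trans hd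
  have hd0 : (p : ℤ) ^ m ∣ α - (1 + 6 * d) := (pow_dvd_pow _ (by omega)).trans hd
  have hes : ((p ^ s : ℕ) : ℤ) ∣ α - (1 + 6 * d) := by
    push_cast
    exact (pow_dvd_pow _ (by omega)).trans hd
  have H' := H.congr_exponent ha hb hes
  have hn0 : (p : ℤ) ^ m ∣ 6 * d := by
    have := dvd_sub hn hd0
    rwa [show α - 1 - (α - (1 + 6 * d)) = 6 * (d : ℤ) by ring] at this
  have hn1 : ¬ (p : ℤ) ^ (m + 1) ∣ 6 * d := fun hx => hn' <| by
    have := dvd_add hx hd1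
    rwa [show 6 * (d : ℤ) + (α - (1 + 6 * d)) = α - 1 by ring] at this
  -- If `p` divides both `6 * d` and `3 * (1 + 2 * d)` then `p = 3`; for `m > 1` one has `3 ∣ d`,
  -- and for `m = 1` the residue `4` modulo `9` excludes it.
  have hnd : ¬ p ∣ 1 + 2 * d := by
    intro hx
    have hp6 : p ∣ 6 * d := by
      have : p ^ m ∣ 6 * d := by exact_mod_cast hn0
      exact (dvd_pow_self _ (by omega)).trans this
    have hp3 : p ∣ 3 := by
      have := (Nat.dvd_add_right hp6).1 (show p ∣ 6 * d + 3 by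
        rw [show 6 * d + 3 = 3 * (1 + 2 * d) by ring]; exact hx.mul_left 3)
      exact this
    obtain rfl : p = 3 := (Nat.prime_dvd_prime_iff_eq hp Nat.prime_three).1 hp3
    rcases Nat.lt_or_ge 1 m with hm1 | hm1
    · have h9 : (9 : ℤ) ∣ 6 * d := by
        have : (3 : ℤ) ^ 2 ∣ 6 * d := (pow_dvd_pow _ hm1).trans hn0
        simpa using this
      omega
    · obtain rfl : m = 1 := by omega
      have h4 := hthree rfl rfl
      have h9 : (9 : ℤ) ∣ α - (1 + 6 * d) := by simpa using hd1
      omega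
  have key := not_pow_dvd_fundamental hp hm (by exact_mod_cast hn0)
    (fun hx => hn1 (by exact_mod_cast hx)) hnd
  refine H'.pow_left_of_fundamental hp hm (by simpa using hn0) ha (k := 1) (M := 1 + 6 * d)
    (by push_cast; ring) fun hX => key ?_
  have hcop : IsCoprime ((p : ℤ) ^ (h + m + 1)) (1 + 6 * d) := by
    refine IsCoprime.pow_left ⟨-(6 * d / p), 1, ?_⟩
    have : (6 * d / p : ℤ) * p = 6 * d :=
      Int.ediv_mul_cancel ((dvd_pow_self _ (by omega)).trans hn0)
    linear_combination -this
  have hexp : 3 * m + 1 - twoDefect p = h + m + 1 := by omega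
  rw [hexp]
  refine hcop.dvd_of_dvd_mul_left ?_
  rw [mul_sub, mul_powSum] at hX
  rw [← dvd_neg]
  rw [show 6 * d + 1 = 1 + 6 * d by ring]
  refine hX.trans (dvd_of_eq ?_)
  ring

theorem pow_left_of_mod_nine (H : MacdonaldTriple α a b c) (hα : α % 9 = 7) {s : ℕ}
    (ha : a ^ 3 ^ s = 1) (hb : b ^ 3 ^ s = 1) :
    a ^ 3 ^ (3 + 1) = 1 ∧ ∃ x : ℤ, a ^ 3 ^ 3 = b ^ x := by
  obtain ⟨d, -, hd⟩ := exists_six_mul_congr Nat.prime_three (α := α) (by push_cast; omega) (s + 2)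
  have hes : ((3 ^ s : ℕ) : ℤ) ∣ α - (1 + 6 * d) := by
    push_cast
    exact (pow_dvd_pow _ (by omega)).trans hd
  have h9 : (9 : ℤ) ∣ α - (1 + 6 * d) := by
    have : (3 : ℤ) ^ 2 ∣ α - (1 + 6 * d) := (pow_dvd_pow _ (by omega)).trans hd
    simpa using this
  have H' := H.congr_exponent ha hb hes
  obtain ⟨k, M, hM, hX⟩ := not_pow_dvd_fundamental_of_mod_nine (a := 1 + 6 * d) (by omega)
  push_cast at hM hX
  exact H'.pow_left_of_fundamental Nat.prime_three (m := 1) le_rfl (by push_cast; omega) ha hM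
    (by push_cast; exact hX)

end MacdonaldTriple

namespace MacdonaldGroup

theorem exists_pow_eq_one_of_isPGroup {T : Type*} [Group T] {p : ℕ} (hT : IsPGroup p T) (a b : T) :
    ∃ s : ℕ, a ^ p ^ s = 1 ∧ b ^ p ^ s = 1 := by
  obtain ⟨k, hk⟩ := hT a
  obtain ⟨l, hl⟩ := hT b
  exact ⟨k + l, by rw [pow_add, pow_mul, hk, one_pow],
    by rw [pow_add, mul_comm, pow_mul, hl, one_pow]⟩

variable {α : ℤ} {p m h : ℕ} {J : Sylow p (MacdonaldGroup α)}
  {π : MacdonaldGroup α →* (J : Subgroup (MacdonaldGroup α))}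

/-- Exponents in a relation between the projected generators are multiples of `p ^ m`, as seen in
the abelianization. -/
theorem pow_dvd_of_relation (hn : (p : ℤ) ^ m ∣ α - 1)
    (hπ : IsSylowProjection J π) {i j : ℤ} {k : ℕ}
    (hr : π (genA α) ^ i * π (genB α) ^ j * π (groupComm (genA α) (genB α)) ^ k = 1) :
    (p : ℤ) ^ m ∣ i ∧ (p : ℤ) ^ m ∣ j := by
  have hz : ∀ u : ZMod (p ^ m), (α : ZMod (p ^ m)) * u = u := by
    intro u
    have : ((α - 1 : ℤ) : ZMod (p ^ m)) = 0 :=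
      (ZMod.intCast_zmod_eq_zero_iff_dvd _ _).2 (by push_cast; exact hn)
    push_cast at this
    rw [sub_eq_zero.1 this, one_mul]
  -- As `α ≡ 1` mod `p ^ m`, any `u`, `v` define a homomorphism from the Macdonald group to `ZMod (p
  -- ^ m)`. The word lies in the kernel of `π`, so its order is prime to `p` and its image in a
  -- `p`-group vanishes.
  have key : ∀ u v : ZMod (p ^ m), (i : ZMod (p ^ m)) * u + j * v = 0 := by
    intro u v
    have ht : MacdonaldTriple α (Multiplicative.ofAdd u) (Multiplicative.ofAdd v) 1 := by
      refine ⟨by rw [mul_one, mul_comm], ?_, ?_⟩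
      · rw [mul_one, one_mul, ← ofAdd_zsmul, zsmul_eq_mul, hz]
      · rw [mul_one, one_mul, ← ofAdd_zsmul, zsmul_eq_mul, hz]
    obtain ⟨φ, hφ1, hφ2⟩ := exists_lift ht
    set g := genA α ^ i * genB α ^ j * groupComm (genA α) (genB α) ^ k with hg
    have hker : g ∈ π.ker := by
      rw [MonoidHom.mem_ker, hg]
      simpa using hr
    have hφ3 : φ (groupComm (genA α) (genB α)) = 1 := by
      simp only [groupComm, map_mul, map_inv]
      rw [mul_assoc, mul_comm (φ (genA α)), ← mul_inv_rev, mul_comm (φ (genB α)),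
        inv_mul_eq_one, mul_comm]
    have hφg : φ g = Multiplicative.ofAdd ((i : ZMod (p ^ m)) * u + j * v) := by
      rw [hg, map_mul, map_mul, map_pow, hφ3, one_pow, mul_one, map_zpow, map_zpow, hφ1, hφ2,
        ← ofAdd_zsmul, ← ofAdd_zsmul, ← ofAdd_add, zsmul_eq_mul, zsmul_eq_mul]
    have h1 : φ g ^ orderOf g = 1 := by rw [← map_pow, pow_orderOf_eq_one, map_one]
    have h2 : φ g ^ p ^ m = 1 := by
      rw [hφg, ← ofAdd_nsmul, nsmul_eq_mul, ZMod.natCast_self, zero_mul, ofAdd_zero]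
    have h3 : φ g = 1 := by
      rw [← orderOf_eq_one_iff]
      exact Nat.eq_one_of_dvd_coprimes ((hπ.2 g hker).pow_right m)
        (orderOf_dvd_of_pow_eq_one h1) (orderOf_dvd_of_pow_eq_one h2)
    rw [hφg] at h3
    exact h3
  constructor
  · have := key 1 0
    rw [mul_one, mul_zero, add_zero, ZMod.intCast_zmod_eq_zero_iff_dvd] at this
    exact_mod_cast this
  · have := key 0 1
    rw [mul_one, mul_zero, zero_add, ZMod.intCast_zmod_eq_zero_iff_dvd] at this
    exact_mod_cast this

/-- If `p`-groups with Macdonald triples satisfy suitable bounds on the orders of the generators, and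
some group with a Macdonald triple attains them, then the Sylow subgroup has the expected normal
form. -/
theorem hasUniqueNormalForm_projection (hp : p.Prime) (hm : 1 ≤ m)
    (hn : (p : ℤ) ^ m ∣ α - 1) (hn' : ¬ (p : ℤ) ^ (m + 1) ∣ α - 1) (hmh : m ≤ h)
    (htwo : p = 2 → h + 1 = 2 * m)
    (hbound : ∀ α' : ℤ, (p : ℤ) ^ (m + 1) ∣ α' - α → ∀ (T : Type) [Group T] (a b c : T) (s : ℕ),
      MacdonaldTriple α' a b c → a ^ p ^ s = 1 → b ^ p ^ s = 1 →
        a ^ p ^ (h + m) = 1 ∧ ∃ x : ℤ, a ^ p ^ h = b ^ x)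
    (hmodel : ∃ α' : ℤ, α' ≠ 0 ∧ α' ≠ 1 ∧ (p : ℤ) ^ (h + m) ∣ α' - α ∧
      ∃ (T : Type) (_ : Group T) (a b c : T), MacdonaldTriple α' a b c ∧
        p ^ (h + m) ∣ orderOf a ∧ p ^ (h + m) ∣ orderOf b)
    (hπ : IsSylowProjection J π) :
    HasUniqueNormalForm (π (genA α)) (π (genB α)) (groupComm (π (genA α)) (π (genB α)))
      (p ^ (h + m)) (p ^ h) (p ^ h) := by
  obtain ⟨α', h0', h1', hα', T, _, a, b, c, ht, hoa, hob⟩ := hmodel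
  have hα'' : (p : ℤ) ^ (m + 1) ∣ α' - α := (pow_dvd_pow _ (by omega)).trans hα'
  -- The model bounds the orders in the group of exponent `α'`, hence in its Sylow `p`-subgroup.
  -- There `hbound` caps the orders, so `α'` may be replaced by `α` and that Sylow subgroup receives
  -- a homomorphism from the group of exponent `α`.
  have hord : p ^ (h + m) ∣ orderOf (genA α) ∧ p ^ (h + m) ∣ orderOf (genB α) := by
    obtain ⟨hfin, hnil⟩ := finite_and_isNilpotent h0' h1'
    obtain ⟨J', -⟩ : ∃ J' : Sylow p (MacdonaldGroup α'), True := ⟨default, trivial⟩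
    obtain ⟨π', hπ'⟩ := exists_isSylowProjection hp J'
    obtain ⟨f, hf1, hf2⟩ := exists_lift ht
    rw [← hf1] at hoa
    rw [← hf2] at hob
    have ka := hπ'.pow_dvd_orderOf (hoa.trans (orderOf_map_dvd f _))
    have kb := hπ'.pow_dvd_orderOf (hob.trans (orderOf_map_dvd f _))
    obtain ⟨s, hs1, hs2⟩ :=
      exists_pow_eq_one_of_isPGroup J'.isPGroup' (π' (genA α')) (π' (genB α'))
    have ht' := (triple α').map π'
    obtain ⟨g, hg1, hg2⟩ := exists_lift (ht'.congr_exponent (α' := α)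
      (hbound α' hα'' _ _ _ _ s ht' hs1 hs2).1 (hbound α' hα'' _ _ _ _ s ht'.swap hs2 hs1).1
      (by push_cast; exact hα'))
    rw [← hg1] at ka
    rw [← hg2] at kb
    exact ⟨ka.trans (orderOf_map_dvd g _), kb.trans (orderOf_map_dvd g _)⟩
  have ht' := (triple α).map π
  obtain ⟨s, hs1, hs2⟩ := exists_pow_eq_one_of_isPGroup J.isPGroup' (π (genA α)) (π (genB α))
  obtain ⟨ha, hab⟩ := hbound α (by simp) _ _ _ _ s ht' hs1 hs2
  obtain ⟨hb, hba⟩ := hbound α (by simp) _ _ _ _ s ht'.swap hs2 hs1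
  rw [← ht'.eq_groupComm]
  refine ht'.hasUniqueNormalForm
    (MacdonaldTriple.closure_map_eq_top (closure_eq_top α) π hπ.surjective) hp hm hn hn'
    (Nat.dvd_antisymm (orderOf_dvd_of_pow_eq_one ha) (hπ.pow_dvd_orderOf hord.1))
    (Nat.dvd_antisymm (orderOf_dvd_of_pow_eq_one hb) (hπ.pow_dvd_orderOf hord.2)) hmh hab hba
    fun h2 => ⟨htwo h2, fun i j k hr => ?_⟩
  have := pow_dvd_of_relation hn hπ hr
  rw [h2] at this
  exact_mod_cast this

theorem hasUniqueNormalForm_of_sub_one_exact (hp : p.Prime)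
    (hm : 1 ≤ m) (hn : (p : ℤ) ^ m ∣ α - 1) (hn' : ¬ (p : ℤ) ^ (m + 1) ∣ α - 1)
    (hthree : p = 3 → m = 1 → α % 9 = 4) (hh : h + twoDefect p = 2 * m)
    (hπ : IsSylowProjection J π) :
    HasUniqueNormalForm (π (genA α)) (π (genB α)) (groupComm (π (genA α)) (π (genB α)))
      (p ^ (h + m)) (p ^ h) (p ^ h) := by
  have hε := twoDefect_le_one p
  refine hasUniqueNormalForm_projection hp hm hn hn' (by omega) ?_ ?_ ?_ hπ
  · rintro rfl
    rw [twoDefect_two] at hh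
    exact hh
  · intro α' hα' T _ a b c s ht ha hb
    refine ht.pow_left_of_sub_one_exact hp hm ?_ ?_ ?_ hh ha hb
    · have := dvd_add ((pow_dvd_pow _ (by omega : m ≤ m + 1)).trans hα') hn
      rwa [show α' - α + (α - 1) = α' - 1 by ring] at this
    · intro hx
      have := dvd_sub hx hα'
      rw [show α' - 1 - (α' - α) = α - 1 by ring] at this
      exact hn' this
    · rintro rfl rfl
      have h4 := hthree rfl rfl
      have h9 : (9 : ℤ) ∣ α' - α := by simpa using hα'
      omega
  · have hpn : (p : ℤ) ∣ α - 1 := (dvd_pow_self _ (by omega)).trans hn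
    obtain ⟨d, hd0, hd⟩ := exists_six_mul_congr hp hpn (h + m)
    have hmd : p ^ m ∣ 6 * d := by
      have := dvd_sub hn ((pow_dvd_pow _ (by omega : m ≤ h + m)).trans hd)
      rw [show α - 1 - (α - (1 + 6 * d)) = 6 * (d : ℤ) by ring] at this
      exact_mod_cast this
    -- Since `2 * (108 * d ^ 3) = (6 * d) ^ 3`, the model's modulus loses one factor exactly for `p
    -- = 2`, matching `h + m = 3 * m - 1`.
    have hQ : p ^ (h + m) ∣ 108 * d ^ 3 := by
      have h3 : p ^ (3 * m) ∣ 2 * (108 * d ^ 3) := by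
        have := pow_dvd_pow_of_dvd hmd 3
        rwa [← pow_mul, mul_comm m, show (6 * d) ^ 3 = 2 * (108 * d ^ 3) by ring] at this
      by_cases h2 : p = 2
      · subst h2
        rw [twoDefect_two] at hh
        rw [show 3 * m = h + m + 1 by omega, pow_succ'] at h3
        exact Nat.dvd_of_mul_dvd_mul_left (by norm_num) h3
      · rw [twoDefect_of_ne h2] at hh
        rw [show h + m = 3 * m by omega]
        refine Nat.Coprime.dvd_of_dvd_mul_left (Nat.Coprime.pow_left _ ?_) h3
        exact (Nat.coprime_primes hp Nat.prime_two).2 h2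
    obtain ⟨T, hT, a, b, c, ht, hoa, hob⟩ := exists_macdonaldTriple_of_six_mul hd0
    exact ⟨1 + 6 * d, by omega, by omega, (dvd_sub_comm).1 hd, T, hT, a, b, c, ht, hQ.trans hoa,
      hQ.trans hob⟩

theorem hasUniqueNormalForm_of_mod_nine (hα : α % 9 = 7) {J : Sylow 3 (MacdonaldGroup α)}
    {π : MacdonaldGroup α →* (J : Subgroup (MacdonaldGroup α))} (hπ : IsSylowProjection J π) :
    HasUniqueNormalForm (π (genA α)) (π (genB α)) (groupComm (π (genA α)) (π (genB α)))
      (3 ^ (3 + 1)) (3 ^ 3) (3 ^ 3) := by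
  refine hasUniqueNormalForm_projection Nat.prime_three (m := 1) le_rfl
    (by push_cast; omega) (by push_cast; omega) (by norm_num) (by norm_num) ?_ ?_ hπ
  · intro α' hα' T _ a b c s ht ha hb
    have h9 : (9 : ℤ) ∣ α' - α := by simpa using hα'
    exact ht.pow_left_of_mod_nine (by omega) ha hb
  · obtain ⟨α', hα', T, hT, a, b, c, ht, hoa, hob⟩ :=
      exists_macdonaldTriple_of_mod_nine (α := (α % 81).toNat) (by omega)
    exact ⟨α', by omega, by omega, by push_cast; omega, T, hT, a, b, c, ht, by simpa using hoa,
      by simpa using hob⟩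

end MacdonaldGroup

open MacdonaldGroup in
theorem theorem7p1 (α : ℤ) (hα : α ≠ 0 ∧ α ≠ 1 ∧ α ≠ 2) (p : ℕ) (hp : p.Prime)
    (hpα : (p : ℤ) ∣ α - 1) (m : ℕ) (hm : m = padicValInt p (α - 1))
    (J : Sylow p (MacdonaldGroup α)) :
    ∃ π : MacdonaldGroup α →* (J : Subgroup (MacdonaldGroup α)), IsSylowProjection J π ∧
      ∃ A B C : (J : Subgroup (MacdonaldGroup α)),
        A = π (MacdonaldGroup.genA α) ∧ B = π (MacdonaldGroup.genB α) ∧ C = groupComm A B ∧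
        (MacdonaldCase1 α p →
          HasUniqueNormalForm A B C (p ^ (3 * m)) (p ^ (2 * m)) (p ^ (2 * m)) ∧
          Nat.card J = p ^ (7 * m)) ∧
        (MacdonaldCase2 p →
          HasUniqueNormalForm A B C (2 ^ (3 * m - 1)) (2 ^ (2 * m - 1)) (2 ^ (2 * m - 1)) ∧
          Nat.card J = 2 ^ (7 * m - 3)) ∧
        (MacdonaldCase3 α p →
          HasUniqueNormalForm A B C 81 27 27 ∧ Nat.card J = 3 ^ 10) := by
  obtain ⟨h0, h1, -⟩ := hα
  obtain ⟨hfin, hnil⟩ := finite_and_isNilpotent h0 h1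
  obtain ⟨π, hπ⟩ := exists_isSylowProjection hp J
  obtain ⟨hm1, hn, hn'⟩ := padicValInt_exact hp (sub_ne_zero.2 h1) hpα
  rw [← hm] at hm1 hn hn'
  refine ⟨π, hπ, _, _, _, rfl, rfl, rfl, fun hc => ?_, fun hc => ?_, fun hc => ?_⟩
  · have hp2 : p ≠ 2 := by
      rcases hc with hc | ⟨rfl, -⟩ <;> omega
    have hthree : p = 3 → m = 1 → α % 9 = 4 := by
      rintro rfl rfl
      rcases hc with hc | ⟨-, hc | hc⟩
      · omega
      · omega
      · have : (α - 1) / 3 % 3 = 1 % 3 := hc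
        push_cast at hpα
        omega
    have hnf := hasUniqueNormalForm_of_sub_one_exact (h := 2 * m) hp hm1 hn hn' hthree
      (by rw [twoDefect_of_ne hp2, add_zero]) hπ
    rw [show 2 * m + m = 3 * m by ring] at hnf
    refine ⟨hnf, ?_⟩
    rw [card_of_hasUniqueNormalForm hnf, ← pow_add, ← pow_add]
    congr 1
    ring
  · obtain rfl : p = 2 := hc
    have hnf := hasUniqueNormalForm_of_sub_one_exact (h := 2 * m - 1) hp hm1 hn hn'
      (by norm_num) (by rw [twoDefect_two]; omega) hπ
    rw [show 2 * m - 1 + m = 3 * m - 1 by omega] at hnf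
    refine ⟨hnf, ?_⟩
    rw [card_of_hasUniqueNormalForm hnf, ← pow_add, ← pow_add]
    congr 1
    omega
  · obtain ⟨rfl, -, hc⟩ := hc
    have hc' : (α - 1) / 3 % 3 = -1 % 3 := hc
    push_cast at hpα
    have hnf := hasUniqueNormalForm_of_mod_nine (by omega) hπ
    exact ⟨by simpa using hnf, by rw [card_of_hasUniqueNormalForm hnf]; norm_num⟩
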